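/- Let $d\ge 2$, and let $f:V_2\to V_1$ be a polynomial-like map of degree $d$: $V_1,V_2\subset\mathbb{C}$ are simply connected domains, $\overline{V_2}$ is a compact subset of $V_1$, and $f$ is a proper holomorphic map of degree $d$. Assume that the filled Julia set $K(f)=\{z\in V_2 : f^{n}(z)\in V_2 \text{ for all } n\ge 0\}$ is connected. Let $\phi:V_1\setminus K(f)\to V_1\setminus K(f)$ be an orientation-preserving homeomorphism that commutes with $f$, that is, $\phi(V_2\setminus K(f))\subset V_2$ and $\phi\circ f=f\circ\phi$ on $V_2\setminus K(f)$. Let $\chi$ be any straightening of $f$: a homeomorphism from a neighbourhood of $K(f)$ onto a neighbourhood of the filled Julia set $K(P)$ of a monic polynomial $P$ of degree $d$, with $\chi(K(f))=K(P)$ and $\chi\circ f=P\circ\chi$ near $K(f)$ (for example a hybrid conjugacy). Let $B:\mathbb{C}\setminus K(P)\to\{|w|>1\}$ be the Böttcher coordinate of $P$, i.e. the conformal isomorphism with $B\circ P=B^{d}$ and $B(z)/z\to1$ as $z\to\infty$. For $\theta\in\mathbb{R}$, the rotation of angle $\theta$ near $K(f)$ is the map $z\mapsto \chi^{-1}\bigl(B^{-1}(e^{i\theta}B(\chi(z)))\bigr)$,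 defined for those $z\notin K(f)$ in the domain of $\chi$ for which $B^{-1}(e^{i\theta}B(\chi(z)))$ lies in the image of $\chi$. Then there is $j\in\{0,\dots,d-2\}$ such that, for the rotation $\rho_j$ of angle $2\pi j/(d-1)$, the composition $\rho_j\circ\phi$ is defined at all points outside $K(f)$ sufficiently close to $K(f)$, and it extends continuously to $K(f)$ by the identity map of $K(f)$. -/

import Mathlib

open Set Filter Topology

namespace PolyLike

/-- `f : V₂ → V₁` is a polynomial-like map of degree `d`: a proper holomorphic map of degree `d`
between simply connected planar domains with `V₂` compactly contained in `V₁`.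
(The values of `f` outside `V₂` play no role.) -/
structure IsPolynomialLike (d : ℕ) (V₂ V₁ : Set ℂ) (f : ℂ → ℂ) : Prop where
  isOpen_dom : IsOpen V₂
  isOpen_cod : IsOpen V₁
  simplyConnected_dom : IsSimplyConnected V₂
  simplyConnected_cod : IsSimplyConnected V₁
  isCompact_closure : IsCompact (closure V₂)
  closure_subset : closure V₂ ⊆ V₁
  mapsTo : MapsTo f V₂ V₁
  holomorphic : DifferentiableOn ℂ f V₂
  proper : ∀ C : Set ℂ, C ⊆ V₁ → IsCompact C → IsCompact (V₂ ∩ f ⁻¹' C)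
  /-- every point has exactly `d` preimages, counted with multiplicity -/
  degree : ∀ w ∈ V₁,
    ∑ᶠ z ∈ {z : ℂ | z ∈ V₂ ∧ f z = w}, analyticOrderNatAt (fun x => f x - w) z = d

/-- The filled Julia set of a polynomial-like map `f : V₂ → V₁`: the points whose whole forward
orbit stays in `V₂`. -/
def filledJulia (V₂ : Set ℂ) (f : ℂ → ℂ) : Set ℂ :=
  {z | ∀ n : ℕ, f^[n] z ∈ V₂}

/-- The filled Julia set of a polynomial: the complement of the basin of infinity. -/
def polyFilledJulia (P : Polynomial ℂ) : Set ℂ :=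
  {z | ¬ Tendsto (fun n : ℕ => (fun x => P.eval x)^[n] z) atTop (cocompact ℂ)}

/-- `B` is the Böttcher coordinate of the monic polynomial `P` with connected filled Julia set:
the conformal isomorphism of the basin of infinity onto the complement of the closed unit disk
that conjugates `P` to `w ↦ w ^ deg P` and is tangent to the identity at infinity. -/
structure IsBottcher (P : Polynomial ℂ) (B : OpenPartialHomeomorph ℂ ℂ) : Prop where
  source_eq : B.source = (polyFilledJulia P)ᶜ
  target_eq : B.target = {w : ℂ | 1 < ‖w‖}
  holomorphic : DifferentiableOn ℂ B B.source
  semiconj : ∀ z ∈ B.source, B (P.eval z) = B z ^ P.natDegree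
  tangent : Tendsto (fun z => B z / z) (cocompact ℂ) (𝓝 1)

/-- `χ` is a straightening of the degree `d` polynomial-like map `f` on `V₂`: a homeomorphism from
a neighbourhood of the filled Julia set of `f` onto a neighbourhood of the filled Julia set of a
monic polynomial `P` of degree `d`, mapping one filled Julia set onto the other and conjugating
`f` to `P`. Every hybrid conjugacy between `f` and `P` is of this kind; quasi-conformality and
`∂̄χ = 0` on the filled Julia set are not demanded. -/
structure IsStraightening (d : ℕ) (V₂ : Set ℂ) (f : ℂ → ℂ) (P : Polynomial ℂ)
    (χ : OpenPartialHomeomorph ℂ ℂ) : Prop where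
  monic : P.Monic
  natDegree_eq : P.natDegree = d
  subset_source : filledJulia V₂ f ⊆ χ.source
  image_eq : χ '' filledJulia V₂ f = polyFilledJulia P
  conj : ∀ z ∈ χ.source, z ∈ V₂ → f z ∈ χ.source → χ (f z) = P.eval (χ z)

/-- The rotation of angle `θ` on the basin of infinity of a polynomial with Böttcher
coordinate `B`. -/
noncomputable def bottcherRotation (B : OpenPartialHomeomorph ℂ ℂ) (θ : ℝ) (w : ℂ) : ℂ :=
  B.symm (Complex.exp (θ * Complex.I) * B w)

/-- The points outside the filled Julia set `K` at which the rotation of angle `θ`, transported by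
the straightening `χ`, is defined. -/
def rotationDomain (K : Set ℂ) (χ B : OpenPartialHomeomorph ℂ ℂ) (θ : ℝ) : Set ℂ :=
  {z | z ∈ χ.source \ K ∧ bottcherRotation B θ (χ z) ∈ χ.target}

/-- The rotation of angle `θ` near the filled Julia set of a polynomial-like map, transported by
the straightening `χ`. -/
noncomputable def rotation (χ B : OpenPartialHomeomorph ℂ ℂ) (θ : ℝ) (z : ℂ) : ℂ :=
  χ.symm (bottcherRotation B θ (χ z))

/-- A homeomorphism `φ` between open subsets of the plane preserves orientation: for every closed
disk in its domain, the image of the positively oriented boundary circle winds exactly once, in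
the positive direction, around the image of the centre. The winding number is read off from a
continuous logarithm `L`. -/
def OrientationPreserving (φ : OpenPartialHomeomorph ℂ ℂ) : Prop :=
  ∀ (z₀ : ℂ) (r : ℝ), 0 < r → Metric.closedBall z₀ r ⊆ φ.source →
    ∃ L : ℝ → ℂ, Continuous L ∧
      (∀ t : ℝ, Complex.exp (L t) = φ (circleMap z₀ r t) - φ z₀) ∧
      L (2 * Real.pi) - L 0 = 2 * Real.pi * Complex.I

open Classical in
/-- The map `ψ`, defined on `D` (a subset of the complement of `K`), extends to `K` as the
identity: `D ∪ K` is a neighbourhood of `K`, and the map that equals `ψ` on `D` and the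
identity on `K` is continuous on `D ∪ K`. -/
def ExtendsAsIdentity (K D : Set ℂ) (ψ : ℂ → ℂ) : Prop :=
  D ∪ K ∈ 𝓝ˢ K ∧ ContinuousOn (fun z => if z ∈ K then z else ψ z) (D ∪ K)

end PolyLike

/-! Write `K` for the filled Julia set of `f` and `τ = 2πi`. The map `k = χ⁻¹ ∘ B⁻¹ ∘ exp`
(`collarMap`) parametrizes a punctured neighbourhood of `K` by a strip `0 < Re ζ < ρ` modulo `τ` and
turns `f` into `ζ ↦ dζ`. As `φ` commutes with `f`, it sends points near `K` to points near `K`, so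
it lifts to a map `G` with `φ ∘ k = k ∘ G`, `G(ζ + τ) = G(ζ) + mτ` and `G(dζ) = dG(ζ) + κτ` for
integers `m`, `κ` (`exists_lift`).

That `m = 1` is topology. For every such parametrization, the winding number of the image of a
vertical line around `K` equals the local degree (`IsCollar.hasWinding_of_hasLocalDegree`), by an
argument principle. Since `φ` preserves orientation, `k` and `φ ∘ k` have the same local degree `ε ≠
0`, whereas `k ∘ G` winds `mε` times. The straightening `χ` may reverse orientation, so only `ε ≠ 0`
is available, and it suffices.

Adding `κτ/(d-1)` to `G`, that is, composing `φ` with the rotation of angle `2πj/(d-1)` where `j ≡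
κ` modulo `d-1`, removes `κ`. The corrected lift commutes with translation by `τ` and with
multiplication by `d`; compactness of a fundamental domain and scaling keep it within bounded
hyperbolic distance of the identity in the right half-plane (`exists_bounds_of_commute`).

Bounded hyperbolic displacement becomes vanishing Euclidean displacement at `K(P)`: for `w₀ ∈ K(P)`
close to `B⁻¹(e^ζ)`, the function `B⁻¹ ∘ exp - w₀` is bounded and zero-free, so a Harnack inequality
makes it small at every point within bounded hyperbolic distance of `ζ`
(`IsBottcher.exists_norm_sub_lt`). No boundary extension of `B⁻¹` is needed. Uniform continuity of
`χ⁻¹` on a compact set carries the estimate back to `K`. -/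

namespace PolyLike

/-- The period of the complex exponential. -/
local notation "τ" => (2 * (Real.pi : ℂ) * Complex.I)

/-! ### Continuous logarithms and winding numbers -/

theorem exists_continuousOn_exp_eq {E : Type*} [NormedAddCommGroup E] [NormedSpace ℝ E]
    {U : Set E} (hU : Convex ℝ U) (hUo : IsOpen U) {F : E → ℂ} (hF : ContinuousOn F U)
    (h0 : ∀ z ∈ U, F z ≠ 0) :
    ∃ L : E → ℂ, ContinuousOn L U ∧ ∀ z ∈ U, Complex.exp (L z) = F z := by
  rcases U.eq_empty_or_nonempty with rfl | hne
  · exact ⟨fun _ => 0, by simp, by simp⟩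
  have : ContractibleSpace U := hU.contractibleSpace hne
  have hs : IsSimplyConnected U := by
    unfold IsSimplyConnected; infer_instance
  obtain ⟨L, hL, hL'⟩ := Complex.exists_continuousOn_eqOn_exp_comp hs hUo hF
    (by rintro ⟨z, hz, hz0⟩; exact h0 z hz hz0)
  exact ⟨L, hL, fun z hz => hL' hz⟩

/-- The difference of the logarithms divided by `τ` is continuous with values in a discrete set,
hence constant on a preconnected set. -/
theorem exists_int_of_exp_eq {X : Type*} [TopologicalSpace X] {S : Set X} (hS : IsPreconnected S)
    {L L' : X → ℂ} (hL : ContinuousOn L S) (hL' : ContinuousOn L' S)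
    (h : ∀ x ∈ S, Complex.exp (L x) = Complex.exp (L' x)) :
    ∃ n : ℤ, ∀ x ∈ S, L x = L' x + n * τ := by
  rcases S.eq_empty_or_nonempty with rfl | ⟨x₀, hx₀⟩
  · exact ⟨0, by simp⟩
  choose! n hn using fun x hx => Complex.exp_eq_exp_iff_exists_int.1 (h x hx)
  refine ⟨n x₀, fun x hx => ?_⟩
  have hdisc : DiscreteTopology (range ((↑) : ℤ → ℝ)) :=
    Int.isClosedEmbedding_coe_real.isEmbedding.toHomeomorph.symm.isEmbedding.discreteTopology
  have hpi : (2 * (Real.pi : ℂ) * Complex.I) ≠ 0 := Complex.two_pi_I_ne_zero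
  have key : ∀ y ∈ S, ((L y - L' y) / τ).re = n y := by
    intro y hy
    rw [hn y hy, add_sub_cancel_left, mul_div_cancel_right₀ _ hpi]
    simp
  have hc : ContinuousOn (fun y => ((L y - L' y) / τ).re) S :=
    Complex.continuous_re.comp_continuousOn ((hL.sub hL').div_const _)
  have := hS.constant_of_mapsTo ⟨hdisc⟩ hc (T := range ((↑) : ℤ → ℝ))
    (fun y hy => ⟨n y, (key y hy).symm⟩) hx hx₀
  rw [key x hx, key x₀ hx₀] at this
  rw [hn x hx]
  norm_cast at this
  rw [this]

/-- The closed curve `γ` of period `2π` winds `n` times around the origin. -/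
def HasWinding (γ : ℝ → ℂ) (n : ℤ) : Prop :=
  ∃ L : ℝ → ℂ, Continuous L ∧ (∀ t, Complex.exp (L t) = γ t) ∧
    ∀ t, L (t + 2 * Real.pi) = L t + n * τ

theorem exists_hasWinding {γ : ℝ → ℂ} (hγ : Continuous γ) (h0 : ∀ t, γ t ≠ 0)
    (hper : ∀ t, γ (t + 2 * Real.pi) = γ t) : ∃ n, HasWinding γ n := by
  obtain ⟨L, hL, hexp⟩ := exists_continuousOn_exp_eq (convex_univ (𝕜 := ℝ)) isOpen_univ
    hγ.continuousOn (fun t _ => h0 t)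
  rw [continuousOn_univ] at hL
  obtain ⟨n, hn⟩ := exists_int_of_exp_eq (S := univ) isPreconnected_univ
    (L := fun t => L (t + 2 * Real.pi)) (L' := L) (by fun_prop) (by fun_prop)
    (fun t _ => by rw [hexp _ trivial, hexp _ trivial, hper])
  exact ⟨n, L, hL, fun t => hexp t trivial, fun t => hn t trivial⟩

theorem HasWinding.unique {γ : ℝ → ℂ} {n m : ℤ} (h : HasWinding γ n) (h' : HasWinding γ m) :
    n = m := by
  obtain ⟨L, hL, hexp, hn⟩ := h
  obtain ⟨L', hL', hexp', hm⟩ := h'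
  obtain ⟨c, hc⟩ := exists_int_of_exp_eq (S := univ) isPreconnected_univ
    hL.continuousOn hL'.continuousOn (fun t _ => by rw [hexp, hexp'])
  have h1 := hc (0 + 2 * Real.pi) trivial
  rw [hn, hm, hc 0 trivial] at h1
  have h2 : (n : ℂ) * τ = m * τ := by linear_combination h1
  exact_mod_cast mul_right_cancel₀ Complex.two_pi_I_ne_zero h2

/-- Rouché: the quotient of the curves stays in the unit disk around `1`, where the principal
logarithm is continuous, so it contributes a periodic correction and no winding. -/
theorem HasWinding.perturb {γ γ' : ℝ → ℂ} {n : ℤ} (h : HasWinding γ n) (hγ' : Continuous γ')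
    (hper : ∀ t, γ' (t + 2 * Real.pi) = γ' t) (hlt : ∀ t, ‖γ' t - γ t‖ < ‖γ t‖) :
    HasWinding γ' n := by
  obtain ⟨L, hL, hexp, hn⟩ := h
  have hγ : Continuous γ := by
    have : γ = fun t => Complex.exp (L t) := funext fun t => (hexp t).symm
    rw [this]; fun_prop
  have h0 : ∀ t, γ t ≠ 0 := fun t => by rw [← hexp]; exact Complex.exp_ne_zero _
  have hγp : ∀ t, γ (t + 2 * Real.pi) = γ t := fun t => by
    rw [← hexp, ← hexp, hn, Complex.exp_add, Complex.exp_int_mul_two_pi_mul_I, mul_one]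
  have hslit : ∀ t, γ' t / γ t ∈ Complex.slitPlane := by
    intro t
    have h1 : ‖(γ' t - γ t) / γ t‖ < 1 := by
      rw [norm_div, div_lt_one (norm_pos_iff.2 (h0 t))]; exact hlt t
    have h2 := Complex.mem_slitPlane_of_norm_lt_one h1
    rwa [sub_div, div_self (h0 t), add_sub_cancel] at h2
  refine ⟨fun t => L t + Complex.log (γ' t / γ t), ?_, fun t => ?_, fun t => ?_⟩
  · exact hL.add (continuous_iff_continuousAt.2 fun t =>
      ((hγ'.div hγ h0).continuousAt).clog (hslit t))
  · rw [Complex.exp_add, hexp, Complex.exp_log (Complex.slitPlane_ne_zero (hslit t)),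
      mul_div_cancel₀ _ (h0 t)]
  · simp only [hn, hper, hγp]; ring

theorem isOpen_setOf_hasWinding_sub {γ : ℝ → ℂ} (hγ : Continuous γ)
    (hper : ∀ t, γ (t + 2 * Real.pi) = γ t) (n : ℤ) :
    IsOpen {q | HasWinding (fun t => γ t - q) n} := by
  rw [Metric.isOpen_iff]
  intro q hq
  have hcl : IsClosed (range γ) := by
    have : range γ = γ '' Icc 0 (0 + 2 * Real.pi) :=
      (Function.Periodic.image_Icc hper (by positivity) 0).symm
    rw [this]; exact (isCompact_Icc.image hγ).isClosed
  have hqr : q ∉ range γ := by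
    rintro ⟨t, ht⟩
    obtain ⟨L, -, hexp, -⟩ := hq
    exact Complex.exp_ne_zero _ ((hexp t).trans (sub_eq_zero.2 ht))
  obtain ⟨r, hr, hball⟩ := Metric.isOpen_iff.1 hcl.isOpen_compl q hqr
  refine ⟨r, hr, fun q' hq' => ?_⟩
  refine HasWinding.perturb hq (by fun_prop) (fun t => by simp only [hper]) fun t => ?_
  have h1 : r ≤ ‖γ t - q‖ := by
    by_contra! hlt
    exact hball (mem_ball_iff_norm.2 hlt) ⟨t, rfl⟩
  have h2 : ‖γ t - q' - (γ t - q)‖ = ‖q' - q‖ := by rw [← norm_neg]; congr 1; ring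
  rw [h2]
  exact (mem_ball_iff_norm.1 hq').trans_le h1

/-- The points with winding number `n` and those with any other value form two disjoint open sets
covering `X`. -/
theorem HasWinding.of_isPreconnected {γ : ℝ → ℂ} (hγ : Continuous γ)
    (hper : ∀ t, γ (t + 2 * Real.pi) = γ t) {X : Set ℂ} (hX : IsPreconnected X)
    (hγX : ∀ t, γ t ∉ X) {q q' : ℂ} (hq : q ∈ X) (hq' : q' ∈ X) {n : ℤ}
    (h : HasWinding (fun t => γ t - q) n) : HasWinding (fun t => γ t - q') n := by
  have hsub := hX.subset_left_of_subset_union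
    (u := {q | HasWinding (fun t => γ t - q) n})
    (v := ⋃ m ∈ {m : ℤ | m ≠ n}, {q | HasWinding (fun t => γ t - q) m})
    (isOpen_setOf_hasWinding_sub hγ hper n)
    (isOpen_biUnion fun m _ => isOpen_setOf_hasWinding_sub hγ hper m) ?_ ?_ ⟨q, hq, h⟩
  · exact hsub hq'
  · rw [Set.disjoint_left]
    intro x hx hx'
    simp only [mem_iUnion] at hx'
    obtain ⟨m, hm, hx'⟩ := hx'
    exact hm (HasWinding.unique hx' hx)
  · intro x hx
    obtain ⟨m, hm⟩ := exists_hasWinding (γ := fun t => γ t - x) (by fun_prop)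
      (fun t h0 => hγX t (by rw [sub_eq_zero.1 h0]; exact hx)) (fun t => by simp only [hper])
    by_cases hmn : m = n
    · left; rw [← hmn]; exact hm
    · right; exact mem_biUnion (show m ∈ {m : ℤ | m ≠ n} from hmn) hm

theorem hasWinding_sub_of_norm_lt {γ : ℝ → ℂ} (hγ : Continuous γ)
    (hper : ∀ t, γ (t + 2 * Real.pi) = γ t) {q : ℂ} (hq : ∀ t, ‖γ t‖ < ‖q‖) :
    HasWinding (fun t => γ t - q) 0 := by
  have hq0 : -q ≠ 0 := neg_ne_zero.2 (norm_pos_iff.1 ((norm_nonneg _).trans_lt (hq 0)))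
  refine HasWinding.perturb (γ := fun _ => -q)
    ⟨fun _ => Complex.log (-q), continuous_const, fun _ => Complex.exp_log hq0, by simp⟩
    (by fun_prop) (fun t => by simp only [hper]) fun t => ?_
  simpa using hq t

/-- The condition bears on the real part alone so that translation by `τ` preserves it. A multiple
of `τ` as `c` serves logarithms, and `c = 0` serves periodic maps. -/
theorem apply_add_int_mul_period {p : ℝ → Prop} {L : ℂ → ℂ} {c : ℂ}
    (h : ∀ s : ℂ, p s.re → L (s + τ) = L s + c) (n : ℤ) :
    ∀ s : ℂ, p s.re → L (s + n * τ) = L s + n * c := by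
  have hre : ∀ (s : ℂ) (m : ℤ), (s + m * τ).re = s.re := by intro s m; simp
  induction n using Int.induction_on with
  | zero => intro s _; simp
  | succ i ih =>
    intro s hs
    have h1 := h (s + (i : ℤ) * τ) (by rwa [hre])
    rw [ih s hs] at h1
    rw [show s + ((i + 1 : ℤ) : ℂ) * τ = s + (i : ℤ) * τ + τ by push_cast; ring, h1]
    push_cast; ring
  | pred i ih =>
    intro s hs
    have h1 := h (s + ((-i - 1 : ℤ) : ℂ) * τ) (by rwa [hre])
    rw [show s + ((-i - 1 : ℤ) : ℂ) * τ + τ = s + (-i : ℤ) * τ by push_cast; ring, ih s hs] at h1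
    push_cast at h1 ⊢; linear_combination -h1

/-! ### Local degree -/

/-- The image under `F` of a small positively oriented circle around `z₀` winds `n` times around
`F z₀`; the winding number is read off in logarithmic coordinates. -/
def HasLocalDegree (F : ℂ → ℂ) (z₀ : ℂ) (n : ℤ) : Prop :=
  ∃ (r : ℝ) (L : ℂ → ℂ), ContinuousOn L {s | s.re < r} ∧
    (∀ s : ℂ, s.re < r → Complex.exp (L s) = F (z₀ + Complex.exp s) - F z₀) ∧
    ∀ s : ℂ, s.re < r → L (s + τ) = L s + n * τ

theorem int_eq_of_mul_period_eq {m n : ℤ} (h : (m : ℂ) * τ = n * τ) : m = n := by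
  exact_mod_cast mul_right_cancel₀ Complex.two_pi_I_ne_zero h

theorem exp_add_period (s : ℂ) : Complex.exp (s + τ) = Complex.exp s := by
  rw [Complex.exp_add, Complex.exp_two_pi_mul_I, mul_one]

theorem re_add_period (s : ℂ) : (s + τ).re = s.re := by simp

theorem convex_re_lt (r : ℝ) : Convex ℝ {s : ℂ | s.re < r} :=
  convex_halfSpace_lt Complex.reLm.isLinear r

theorem isOpen_re_lt (r : ℝ) : IsOpen {s : ℂ | s.re < r} :=
  isOpen_lt Complex.continuous_re continuous_const

theorem exists_log_punctured_ball {F : ℂ → ℂ} {z₀ : ℂ} {r : ℝ}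
    (hF : ContinuousOn F (Metric.ball z₀ (Real.exp r)))
    (hne : ∀ z ∈ Metric.ball z₀ (Real.exp r), z ≠ z₀ → F z ≠ F z₀) :
    ∃ (L : ℂ → ℂ) (n : ℤ), ContinuousOn L {s | s.re < r} ∧
    (∀ s : ℂ, s.re < r → Complex.exp (L s) = F (z₀ + Complex.exp s) - F z₀) ∧
    ∀ s : ℂ, s.re < r → L (s + τ) = L s + n * τ := by
  have hmem : ∀ s : ℂ, s.re < r → z₀ + Complex.exp s ∈ Metric.ball z₀ (Real.exp r) := by
    intro s hs
    rw [mem_ball_iff_norm, add_sub_cancel_left, Complex.norm_exp]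
    exact Real.exp_lt_exp.2 hs
  obtain ⟨L, hL, hexp⟩ := exists_continuousOn_exp_eq (convex_re_lt r) (isOpen_re_lt r)
    (F := fun s => F (z₀ + Complex.exp s) - F z₀)
    ((hF.comp (by fun_prop) (fun s hs => hmem s hs)).sub continuousOn_const)
    (fun s hs => sub_ne_zero.2 (hne _ (hmem s hs) (by simp)))
  obtain ⟨n, hn⟩ := exists_int_of_exp_eq (convex_re_lt r).isPreconnected
    (L := fun s => L (s + τ)) (L' := L)
    (hL.comp (by fun_prop) (fun s hs => by simpa using hs)) hL (fun s hs => by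
      rw [hexp _ hs, hexp _ (by simpa using hs), exp_add_period])
  exact ⟨L, n, hL, hexp, hn⟩

theorem exists_hasLocalDegree {F : ℂ → ℂ} {z₀ : ℂ} {U : Set ℂ} (hU : U ∈ 𝓝 z₀)
    (hF : ContinuousOn F U) (hinj : InjOn F U) : ∃ n, HasLocalDegree F z₀ n := by
  obtain ⟨ε, hε, hball⟩ := Metric.mem_nhds_iff.1 hU
  obtain ⟨L, n, h⟩ := exists_log_punctured_ball (F := F) (z₀ := z₀) (r := Real.log ε)
    (hF.mono (by rwa [Real.exp_log hε])) (fun z hz hne heq => hne (hinj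
      (hball (by rwa [Real.exp_log hε] at hz)) (hball (Metric.mem_ball_self hε)) heq))
  exact ⟨n, Real.log ε, L, h⟩

theorem HasLocalDegree.unique {F : ℂ → ℂ} {z₀ : ℂ} {n m : ℤ} (h : HasLocalDegree F z₀ n)
    (h' : HasLocalDegree F z₀ m) : n = m := by
  obtain ⟨r, L, hL, hexp, hn⟩ := h
  obtain ⟨r', L', hL', hexp', hm⟩ := h'
  have hr : ∀ s : ℂ, s.re < min r r' → s.re < r := fun s hs => hs.trans_le (min_le_left _ _)
  have hr' : ∀ s : ℂ, s.re < min r r' → s.re < r' := fun s hs => hs.trans_le (min_le_right _ _)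
  obtain ⟨c, hc⟩ := exists_int_of_exp_eq (convex_re_lt (min r r')).isPreconnected
    (hL.mono hr) (hL'.mono hr') (fun s hs => by rw [hexp _ (hr s hs), hexp' _ (hr' s hs)])
  have hs : ((min r r' - 1 : ℝ) : ℂ).re < min r r' := by rw [Complex.ofReal_re]; linarith
  have h1 := hc (((min r r' - 1 : ℝ) : ℂ) + τ) (by rw [mem_ofPred_eq, re_add_period]; exact hs)
  rw [hn _ (hr _ hs), hm _ (hr' _ hs), hc _ hs] at h1
  have h2 : (n : ℂ) * τ = m * τ := by linear_combination h1
  exact_mod_cast mul_right_cancel₀ Complex.two_pi_I_ne_zero h2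

/-- Logarithmic lifts compose: one period of `s` adds `n` periods to `L`, and each of these adds `m`
periods to `L'`. -/
theorem HasLocalDegree.comp {F G : ℂ → ℂ} {z₀ : ℂ} {n m : ℤ} (hG : HasLocalDegree G (F z₀) m)
    (hF : HasLocalDegree F z₀ n) (hFc : ContinuousAt F z₀) :
    HasLocalDegree (G ∘ F) z₀ (m * n) := by
  obtain ⟨r, L, hL, hexp, hn⟩ := hF
  obtain ⟨r', L', hL', hexp', hm⟩ := hG
  obtain ⟨δ, hδ, hδF⟩ := Metric.continuousAt_iff.1 hFc (Real.exp r') (Real.exp_pos _)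
  set r'' := min r (Real.log δ)
  have hr : ∀ s : ℂ, s.re < r'' → s.re < r := fun s hs => hs.trans_le (min_le_left _ _)
  have hre : ∀ s : ℂ, s.re < r'' → (L s).re < r' := by
    intro s hs
    rw [← Real.exp_lt_exp, ← Complex.norm_exp, hexp s (hr s hs), ← dist_eq_norm]
    apply hδF
    rw [dist_eq_norm, add_sub_cancel_left, Complex.norm_exp, ← Real.exp_log hδ]
    exact Real.exp_lt_exp.2 (hs.trans_le (min_le_right _ _))
  refine ⟨r'', L' ∘ L, ?_, fun s hs => ?_, fun s hs => ?_⟩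
  · exact hL'.comp (hL.mono hr) hre
  · simp only [Function.comp_apply]
    rw [hexp' _ (hre s hs), hexp s (hr s hs), add_sub_cancel]
  · simp only [Function.comp_apply]
    rw [hn s (hr s hs), apply_add_int_mul_period (p := (· < r')) hm n _ (hre s hs)]
    push_cast; ring

theorem hasLocalDegree_id (z₀ : ℂ) : HasLocalDegree id z₀ 1 :=
  ⟨0, id, continuousOn_id, by simp, by simp⟩

theorem HasLocalDegree.congr {F G : ℂ → ℂ} {z₀ : ℂ} {n : ℤ} (h : HasLocalDegree F z₀ n)
    (hFG : F =ᶠ[𝓝 z₀] G) : HasLocalDegree G z₀ n := by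
  obtain ⟨r, L, hL, hexp, hn⟩ := h
  obtain ⟨ε, hε, hball⟩ := Metric.mem_nhds_iff.1 hFG
  have hr : ∀ s : ℂ, s.re < min r (Real.log ε) → s.re < r :=
    fun s hs => hs.trans_le (min_le_left _ _)
  refine ⟨min r (Real.log ε), L, hL.mono hr, fun s hs => ?_, fun s hs => hn s (hr s hs)⟩
  have h1 : F (z₀ + Complex.exp s) = G (z₀ + Complex.exp s) := by
    apply hball
    rw [mem_ball_iff_norm, add_sub_cancel_left, Complex.norm_exp, ← Real.exp_log hε]
    exact Real.exp_lt_exp.2 (hs.trans_le (min_le_right _ _))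
  rw [hexp s (hr s hs), h1, hFG.eq_of_nhds]

/-- The hypothesis gives the winding along a single circle; a logarithm on the whole punctured disk
has the same increment there, which fixes its degree. -/
theorem OrientationPreserving.hasLocalDegree {φ : OpenPartialHomeomorph ℂ ℂ}
    (hφ : OrientationPreserving φ) {z₀ : ℂ} (hz₀ : z₀ ∈ φ.source) : HasLocalDegree φ z₀ 1 := by
  obtain ⟨ε, hε, hball⟩ := Metric.isOpen_iff.1 φ.open_source z₀ hz₀
  have hsub : Metric.ball z₀ (Real.exp (Real.log ε)) ⊆ φ.source := by rwa [Real.exp_log hε]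
  obtain ⟨Λ, n, hΛ, hexp, hn⟩ := exists_log_punctured_ball (F := φ) (z₀ := z₀) (r := Real.log ε)
    (φ.continuousOn.mono hsub) (fun z hz hne heq => hne (φ.injOn (hsub hz) hz₀ heq))
  obtain ⟨L, hL, hLexp, hLd⟩ := hφ z₀ (ε / 2) (by positivity)
    ((Metric.closedBall_subset_ball (by linarith)).trans hball)
  have hre : ∀ t : ℝ, (Real.log (ε / 2) + t * Complex.I : ℂ).re < Real.log ε := by
    intro t
    have : (Real.log (ε / 2) + t * Complex.I : ℂ).re = Real.log (ε / 2) := by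
      rw [Complex.add_re, Complex.ofReal_re]; simp
    rw [this]
    exact Real.log_lt_log (by positivity) (by linarith)
  obtain ⟨c, hc⟩ := exists_int_of_exp_eq (S := univ) isPreconnected_univ
    (L := L) (L' := fun t : ℝ => Λ (Real.log (ε / 2) + t * Complex.I)) hL.continuousOn
    (hΛ.comp (by fun_prop) (fun t _ => hre t)) (fun t _ => by
      rw [hLexp, hexp _ (hre t), Complex.exp_add, ← Complex.ofReal_exp,
        Real.exp_log (by positivity)]
      rfl)
  have h2 := hc (2 * Real.pi) trivial
  have h0 := hc 0 trivial
  have h3 := hn _ (hre 0)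
  have h4 : ((2 * Real.pi : ℝ) : ℂ) * Complex.I = ((0 : ℝ) : ℂ) * Complex.I + τ := by
    push_cast; ring
  simp only [h4, ← add_assoc] at h2
  rw [h3] at h2
  have h5 : (n : ℂ) * τ = (1 : ℤ) * τ := by push_cast; linear_combination hLd - h2 + h0
  have : n = 1 := by exact_mod_cast mul_right_cancel₀ Complex.two_pi_I_ne_zero h5
  exact ⟨Real.log ε, Λ, hΛ, hexp, this ▸ hn⟩

/-! ### Strips and the argument principle -/

/-- The vertical strip `0 < Re ζ < ρ`. -/
def strip (ρ : ℝ) : Set ℂ := {ζ | 0 < ζ.re ∧ ζ.re < ρ}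

theorem convex_re_mem_Ioo (a b : ℝ) : Convex ℝ {ζ : ℂ | a < ζ.re ∧ ζ.re < b} :=
  (convex_halfSpace_gt Complex.reLm.isLinear a).inter (convex_halfSpace_lt Complex.reLm.isLinear b)

theorem isOpen_re_mem_Ioo (a b : ℝ) : IsOpen {ζ : ℂ | a < ζ.re ∧ ζ.re < b} :=
  (isOpen_lt continuous_const Complex.continuous_re).inter
    (isOpen_lt Complex.continuous_re continuous_const)

theorem convex_strip (ρ : ℝ) : Convex ℝ (strip ρ) := convex_re_mem_Ioo 0 ρ

theorem isOpen_strip (ρ : ℝ) : IsOpen (strip ρ) := isOpen_re_mem_Ioo 0 ρ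

theorem strip_mono {a b : ℝ} (h : a ≤ b) : strip a ⊆ strip b := fun _ hζ => ⟨hζ.1, hζ.2.trans_le h⟩

/-- On a vertical strip avoiding the zeros, a `2πi`-periodic function has a logarithm whose
increment over a period is the winding number along any vertical line. -/
theorem exists_log_on_strip {F : ℂ → ℂ} {a b x : ℝ} {y : ℝ} {n : ℤ} (hax : a < x) (hxb : x < b)
    (hF : ContinuousOn F {ζ : ℂ | a < ζ.re ∧ ζ.re < b})
    (h0 : ∀ ζ : ℂ, a < ζ.re → ζ.re < b → F ζ ≠ 0)
    (hper : ∀ ζ : ℂ, a < ζ.re → ζ.re < b → F (ζ + τ) = F ζ)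
    (hn : HasWinding (fun t => F (x + (t + y) * Complex.I)) n) :
    ∃ L : ℂ → ℂ, ContinuousOn L {ζ : ℂ | a < ζ.re ∧ ζ.re < b} ∧
      (∀ ζ : ℂ, a < ζ.re ∧ ζ.re < b → Complex.exp (L ζ) = F ζ) ∧
      ∀ ζ : ℂ, a < ζ.re ∧ ζ.re < b → L (ζ + τ) = L ζ + n * τ := by
  obtain ⟨L, hL, hexp⟩ := exists_continuousOn_exp_eq (convex_re_mem_Ioo a b)
    (isOpen_re_mem_Ioo a b) hF (fun ζ hζ => h0 ζ hζ.1 hζ.2)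
  obtain ⟨m, hm⟩ := exists_int_of_exp_eq (convex_re_mem_Ioo a b).isPreconnected
    (L := fun s => L (s + τ)) (L' := L)
    (hL.comp (by fun_prop) (fun s hs => by simpa using hs)) hL (fun s hs => by
      rw [hexp _ hs, hexp _ (by simpa using hs), hper _ hs.1 hs.2])
  have hmem : ∀ t : ℝ, (x + (t + y) * Complex.I : ℂ) ∈ {ζ : ℂ | a < ζ.re ∧ ζ.re < b} := by
    intro t; simp [hax, hxb]
  have hmn : m = n := by
    refine HasWinding.unique ⟨fun t : ℝ => L (x + (t + y) * Complex.I), ?_, fun t => ?_,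
      fun t => ?_⟩ hn
    · exact hL.comp_continuous (by fun_prop) hmem
    · exact hexp _ (hmem t)
    · have := hm _ (hmem t)
      simp only [← this]
      congr 1; push_cast; ring
  exact ⟨L, hL, hexp, hmn ▸ hm⟩

/-- An argument principle for continuous maps. By injectivity modulo `τ`, the zeros of `F` in its
strip are the multiples of `τ`, one per period, so the windings to the right and to the left of them
differ by the local degree. Branches of the logarithm on the two sides and between consecutive zeros
are compared with one along a small circle. -/
theorem localDegree_eq_winding_sub_winding {k : ℂ → ℂ} {ρ : ℝ} (hk : ContinuousOn k (strip ρ))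
    (hper : ∀ ζ, k (ζ + τ) = k ζ)
    (hinj : ∀ ζ ∈ strip ρ, ∀ ζ' ∈ strip ρ, k ζ = k ζ' → ∃ n : ℤ, ζ = ζ' + n * τ)
    {η : ℂ} {x₁ x₂ : ℝ} (hx₁ : 0 < x₁) (h₁ : x₁ < η.re) (h₂ : η.re < x₂) (hx₂ : x₂ < ρ)
    {ε a b : ℤ} (hε : HasLocalDegree k η ε)
    (ha : HasWinding (fun t => k (x₂ + t * Complex.I) - k η) a)
    (hb : HasWinding (fun t => k (x₁ + t * Complex.I) - k η) b) : ε = a - b := by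
  set σ := η.re with hσ
  set F : ℂ → ℂ := fun δ => k (η + δ) - k η with hFdef
  have hFper : ∀ δ, F (δ + τ) = F δ := fun δ => by simp only [hFdef, ← add_assoc, hper]
  have hmaps : ∀ δ : ℂ, -σ < δ.re → δ.re < ρ - σ → η + δ ∈ strip ρ := by
    intro δ h1 h2
    constructor <;> rw [Complex.add_re] <;> linarith
  have hη : η ∈ strip ρ := ⟨by linarith, by linarith⟩
  have hF : ContinuousOn F {δ : ℂ | -σ < δ.re ∧ δ.re < ρ - σ} :=
    (hk.comp (by fun_prop) (fun δ hδ => hmaps δ hδ.1 hδ.2)).sub continuousOn_const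
  have hF0 : ∀ δ : ℂ, -σ < δ.re → δ.re < ρ - σ → F δ = 0 → ∃ n : ℤ, δ = n * τ := by
    intro δ h1 h2 h
    obtain ⟨n, hn⟩ := hinj _ (hmaps δ h1 h2) _ hη (sub_eq_zero.1 h)
    exact ⟨n, add_left_cancel hn⟩
  have hF0re : ∀ δ : ℂ, -σ < δ.re → δ.re < ρ - σ → δ.re ≠ 0 → F δ ≠ 0 := by
    intro δ h1 h2 h h0
    obtain ⟨n, rfl⟩ := hF0 δ h1 h2 h0
    simp at h
  -- logarithms to the right and to the left of the zero
  obtain ⟨R, hR, hRexp, hRper⟩ := exists_log_on_strip (F := F) (a := 0) (b := ρ - σ)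
    (x := x₂ - σ) (y := -η.im) (n := a) (by linarith) (by linarith)
    (hF.mono fun δ hδ => ⟨by linarith [hδ.1], hδ.2⟩)
    (fun δ h1 h2 => hF0re δ (by linarith) h2 h1.ne') (fun δ _ _ => hFper δ) (by
      convert ha using 4 with t
      apply Complex.ext <;> simp [hσ])
  obtain ⟨M, hM, hMexp, hMper⟩ := exists_log_on_strip (F := F) (a := -σ) (b := 0)
    (x := x₁ - σ) (y := -η.im) (n := b) (by linarith) (by linarith)
    (hF.mono fun δ hδ => ⟨hδ.1, by linarith [hδ.2]⟩)
    (fun δ h1 h2 => hF0re δ h1 (by linarith) h2.ne) (fun δ _ _ => hFper δ) (by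
      convert hb using 4 with t
      apply Complex.ext <;> simp [hσ])
  -- a logarithm between consecutive zeros
  set Q : Set ℂ := {δ : ℂ | -σ < δ.re ∧ δ.re < ρ - σ} ∩ {δ : ℂ | 0 < δ.im ∧ δ.im < 2 * Real.pi}
  have himc : Convex ℝ {δ : ℂ | 0 < δ.im ∧ δ.im < 2 * Real.pi} :=
    (convex_halfSpace_gt Complex.imLm.isLinear _).inter
      (convex_halfSpace_lt Complex.imLm.isLinear _)
  have hQc : Convex ℝ Q := (convex_re_mem_Ioo _ _).inter himc
  have hQo : IsOpen Q := (isOpen_re_mem_Ioo _ _).inter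
    ((isOpen_lt continuous_const Complex.continuous_im).inter
      (isOpen_lt Complex.continuous_im continuous_const))
  obtain ⟨N, hN, hNexp⟩ := exists_continuousOn_exp_eq hQc hQo (hF.mono inter_subset_left)
    (fun δ hδ h0 => by
      obtain ⟨n, rfl⟩ := hF0 δ hδ.1.1 hδ.1.2 h0
      have h1 := hδ.2.1
      have h2 := hδ.2.2
      have h3 : ((n : ℂ) * τ).im = n * (2 * Real.pi) := by simp
      rw [h3] at h1 h2
      have hpi : 0 < 2 * Real.pi := by positivity
      have h4 : (0 : ℝ) < n := by
        by_contra! hcon; nlinarith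
      have h5 : (n : ℝ) < 1 := by
        by_contra! hcon; nlinarith
      norm_cast at h4 h5
      omega)
  obtain ⟨α, hα⟩ := exists_int_of_exp_eq
    ((convex_re_mem_Ioo 0 (ρ - σ)).inter himc).isPreconnected
    (hR.mono inter_subset_left) (hN.mono fun δ hδ => ⟨⟨by linarith [hδ.1.1], hδ.1.2⟩, hδ.2⟩)
    (fun δ hδ => by rw [hRexp δ hδ.1, hNexp δ ⟨⟨by linarith [hδ.1.1], hδ.1.2⟩, hδ.2⟩])
  obtain ⟨β, hβ⟩ := exists_int_of_exp_eq
    ((convex_re_mem_Ioo (-σ) 0).inter himc).isPreconnected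
    (hM.mono inter_subset_left) (hN.mono fun δ hδ => ⟨⟨hδ.1.1, by linarith [hδ.1.2]⟩, hδ.2⟩)
    (fun δ hδ => by rw [hMexp δ hδ.1, hNexp δ ⟨⟨hδ.1.1, by linarith [hδ.1.2]⟩, hδ.2⟩])
  -- the logarithm along a small circle
  obtain ⟨r, Λ, hΛ, hΛexp, hΛper⟩ := hε
  obtain ⟨s₀, hs₀r, hs₀⟩ : ∃ s₀ : ℝ, s₀ < r ∧
      Real.exp s₀ < min σ (min (ρ - σ) (2 * Real.pi)) := by
    have hpos : 0 < min σ (min (ρ - σ) (2 * Real.pi)) :=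
      lt_min (by linarith) (lt_min (by linarith) (by positivity))
    have := (Real.tendsto_exp_atBot.eventually (gt_mem_nhds hpos)).and (eventually_lt_atBot r)
    obtain ⟨s, h1, h2⟩ := this.exists
    exact ⟨s, h2, h1⟩
  have he1 : Real.exp s₀ < σ := hs₀.trans_le (min_le_left _ _)
  have he2 : Real.exp s₀ < ρ - σ := hs₀.trans_le ((min_le_right _ _).trans (min_le_left _ _))
  have he3 : Real.exp s₀ < 2 * Real.pi :=
    hs₀.trans_le ((min_le_right _ _).trans (min_le_right _ _))
  have he0 := Real.exp_pos s₀
  set s : ℝ → ℂ := fun t => s₀ + t * Complex.I with hs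
  set e : ℝ → ℂ := fun t => Complex.exp (s t) with he
  have hsre : ∀ t, (s t).re < r := fun t => by simp [hs, hs₀r]
  have here : ∀ t, (e t).re = Real.exp s₀ * Real.cos t := fun t => by
    simp [he, hs, Complex.exp_re]
  have heim : ∀ t, (e t).im = Real.exp s₀ * Real.sin t := fun t => by
    simp [he, hs, Complex.exp_im]
  have hel : ∀ t, -σ < (e t).re := fun t => by
    rw [here]; nlinarith [Real.neg_one_le_cos t]
  have heu : ∀ t, (e t).re < ρ - σ := fun t => by
    rw [here]; nlinarith [Real.cos_le_one t]
  have hs_per : ∀ t, s (t + 2 * Real.pi) = s t + τ := fun t => by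
    simp only [hs]; push_cast; ring
  have he_per : ∀ t, e (t + 2 * Real.pi) = e t := fun t => by
    simp only [he]; rw [hs_per, exp_add_period]
  have arc : ∀ (J : ℂ → ℂ) (S : Set ℂ) (u v : ℝ), ContinuousOn J S →
      (∀ δ ∈ S, Complex.exp (J δ) = F δ) → (∀ t ∈ Ioo u v, e t ∈ S) →
      ∃ c : ℤ, ∀ t ∈ Ioo u v, Λ (s t) = J (e t) + c * τ := by
    intro J S u v hJ hJexp hmem
    refine exists_int_of_exp_eq isPreconnected_Ioo
      (hΛ.comp (by fun_prop) fun t _ => hsre t) (hJ.comp (by fun_prop) hmem) fun t ht => ?_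
    rw [hΛexp _ (hsre t), hJexp _ (hmem t ht)]
  have hpi := Real.pi_pos
  have hmR : ∀ t ∈ Ioo (-(Real.pi / 2)) (Real.pi / 2), 0 < (e t).re ∧ (e t).re < ρ - σ :=
    fun t ht => ⟨by rw [here]; exact mul_pos he0 (Real.cos_pos_of_mem_Ioo ht), heu t⟩
  have hmN : ∀ t ∈ Ioo 0 Real.pi, e t ∈ Q := fun t ht => ⟨⟨hel t, heu t⟩, by
    rw [mem_ofPred_eq, heim]
    exact ⟨mul_pos he0 (Real.sin_pos_of_mem_Ioo ht), by nlinarith [Real.sin_le_one t]⟩⟩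
  have hmM : ∀ t ∈ Ioo (Real.pi / 2) (Real.pi + Real.pi / 2), -σ < (e t).re ∧ (e t).re < 0 :=
    fun t ht => ⟨hel t, by
      rw [here]
      exact mul_neg_of_pos_of_neg he0 (Real.cos_neg_of_pi_div_two_lt_of_lt ht.1 ht.2)⟩
  obtain ⟨c₁, hc₁⟩ := arc R _ _ _ hR hRexp hmR
  obtain ⟨c₂, hc₂⟩ := arc N Q _ _ hN hNexp hmN
  obtain ⟨c₃, hc₃⟩ := arc M _ _ _ hM hMexp hmM
  -- The lower arc lies outside `Q`; one period up it enters `Q` from above the zero to below the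
  -- next one, so the same branch `N` is usable.
  have hQ4 : ∀ t ∈ Ioo (-Real.pi) 0, e t + τ ∈ Q := fun t ht => by
    have h3 : (e t + τ).im = (e t).im + 2 * Real.pi := by simp
    refine ⟨by rw [mem_ofPred_eq, re_add_period]; exact ⟨hel t, heu t⟩, ?_⟩
    rw [mem_ofPred_eq, h3, heim]
    exact ⟨by nlinarith [Real.neg_one_le_sin t],
      by nlinarith [Real.sin_neg_of_neg_of_neg_pi_lt ht.2 ht.1]⟩
  obtain ⟨c₄, hc₄⟩ := arc (fun δ => N (δ + τ)) {δ | δ + τ ∈ Q} (-Real.pi) 0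
    (hN.comp (by fun_prop) fun δ hδ => hδ) (fun δ hδ => by rw [hNexp _ hδ, hFper]) hQ4
  -- The branches are matched at the angles `π/4`, `3π/4`, `-3π/4`, `-π/4`. Shifting by `τ` costs
  -- `b` on the left and `a` on the right, and closing the circle costs `ε`; eliminating the
  -- constants leaves `ε = a - b`.
  have e12 : c₂ = c₁ + α := by
    have ht1 : Real.pi / 4 ∈ Ioo (-(Real.pi / 2)) (Real.pi / 2) := ⟨by linarith, by linarith⟩
    have ht2 : Real.pi / 4 ∈ Ioo 0 Real.pi := ⟨by linarith, by linarith⟩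
    apply int_eq_of_mul_period_eq
    push_cast
    linear_combination hc₁ _ ht1 - hc₂ _ ht2 + hα _ ⟨hmR _ ht1, (hmN _ ht2).2⟩
  have e23 : c₂ = c₃ + β := by
    have ht1 : 3 * Real.pi / 4 ∈ Ioo (Real.pi / 2) (Real.pi + Real.pi / 2) :=
      ⟨by linarith, by linarith⟩
    have ht2 : 3 * Real.pi / 4 ∈ Ioo 0 Real.pi := ⟨by linarith, by linarith⟩
    apply int_eq_of_mul_period_eq
    push_cast
    linear_combination hc₃ _ ht1 - hc₂ _ ht2 + hβ _ ⟨hmM _ ht1, (hmN _ ht2).2⟩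
  have e34 : c₃ + β - b = c₄ + ε := by
    have ht1 : -(3 * Real.pi / 4) + 2 * Real.pi ∈ Ioo (Real.pi / 2) (Real.pi + Real.pi / 2) :=
      ⟨by linarith, by linarith⟩
    have ht2 : -(3 * Real.pi / 4) ∈ Ioo (-Real.pi) 0 := ⟨by linarith, by linarith⟩
    have h1 := hc₃ _ ht1
    have h2 := hmM _ ht1
    rw [he_per] at h2
    rw [hs_per, he_per, hΛper _ (hsre _)] at h1
    apply int_eq_of_mul_period_eq
    push_cast
    linear_combination hc₄ _ ht2 - h1 + hMper _ h2
      - hβ (e (-(3 * Real.pi / 4)) + τ) ⟨by rw [mem_ofPred_eq, re_add_period]; exact h2,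
        (hQ4 _ ht2).2⟩
  have e41 : c₄ = c₁ + α - a := by
    have ht1 : -(Real.pi / 4) ∈ Ioo (-(Real.pi / 2)) (Real.pi / 2) :=
      ⟨by linarith, by linarith⟩
    have ht2 : -(Real.pi / 4) ∈ Ioo (-Real.pi) 0 := ⟨by linarith, by linarith⟩
    apply int_eq_of_mul_period_eq
    push_cast
    linear_combination hc₁ _ ht1 - hc₄ _ ht2 - hRper _ (hmR _ ht1)
      + hα (e (-(Real.pi / 4)) + τ) ⟨by rw [mem_ofPred_eq, re_add_period]; exact hmR _ ht1,
        (hQ4 _ ht2).2⟩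
  omega

/-! ### Collars of a compact set -/

theorem isCompact_of_forall_isOpen {X : Type*} [TopologicalSpace X] {K S : Set X}
    (hK : IsCompact K) (hKS : K ⊆ S)
    (h : ∀ U, IsOpen U → K ⊆ U → ∃ C ⊆ S, IsCompact C ∧ S ⊆ U ∪ C) : IsCompact S := by
  classical
  refine isCompact_of_finite_subcover fun {ι} V hV hSV => ?_
  obtain ⟨t, ht⟩ := hK.elim_finite_subcover V hV (hKS.trans hSV)
  obtain ⟨C, hCS, hC, hSC⟩ := h _ (isOpen_biUnion fun i (_ : i ∈ t) => hV i) ht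
  obtain ⟨t', ht'⟩ := hC.elim_finite_subcover V hV (hCS.trans hSV)
  refine ⟨t ∪ t', fun z hz => ?_⟩
  rw [Finset.set_biUnion_union]
  exact (hSC hz).imp id fun hzC => ht' hzC

theorem exists_int_im_mem_Icc (ζ : ℂ) : ∃ n : ℤ, (ζ + n * τ).im ∈ Icc 0 (2 * Real.pi) := by
  have hpi : 0 < 2 * Real.pi := by positivity
  refine ⟨-⌊ζ.im / (2 * Real.pi)⌋, ?_⟩
  have h1 : (ζ + ((-⌊ζ.im / (2 * Real.pi)⌋ : ℤ) : ℂ) * τ).im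
      = ζ.im - ⌊ζ.im / (2 * Real.pi)⌋ * (2 * Real.pi) := by simp; ring
  have h2 := Int.floor_le (ζ.im / (2 * Real.pi))
  have h3 := Int.lt_floor_add_one (ζ.im / (2 * Real.pi))
  rw [le_div_iff₀ hpi] at h2
  rw [div_lt_iff₀ hpi] at h3
  rw [h1]
  constructor <;> linarith

theorem isCompact_image_re_mem_Icc {k : ℂ → ℂ} {a b : ℝ}
    (hk : ContinuousOn k {ζ : ℂ | ζ.re ∈ Icc a b})
    (hper : ∀ ζ : ℂ, ζ.re ∈ Icc a b → k (ζ + τ) = k ζ) :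
    IsCompact (k '' {ζ : ℂ | ζ.re ∈ Icc a b}) := by
  have : k '' {ζ : ℂ | ζ.re ∈ Icc a b} = k '' (Icc a b ×ℂ Icc 0 (2 * Real.pi)) := by
    apply Subset.antisymm
    · rintro _ ⟨ζ, hζ, rfl⟩
      obtain ⟨n, hn⟩ := exists_int_im_mem_Icc ζ
      refine ⟨ζ + n * τ, ⟨?_, hn⟩, ?_⟩
      · have : (ζ + n * τ).re = ζ.re := by simp
        rw [mem_preimage, this]; exact hζ
      · have := apply_add_int_mul_period (p := fun r => r ∈ Icc a b) (L := k) (c := 0)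
          (fun s hs => by rw [hper s hs, add_zero]) n ζ hζ
        simpa using this
    · exact image_mono fun ζ hζ => hζ.1
  rw [this]
  exact (isCompact_Icc.reProdIm isCompact_Icc).image_of_continuousOn (hk.mono fun ζ hζ => hζ.1)

/-- `k` parametrizes, in logarithmic coordinates, a one-sided tubular neighbourhood of `K`: it
induces an injection of the annulus `{0 < Re ζ < ρ} / 2πiℤ` into the complement of `K`, the end
`Re ζ → 0` tends to `K`, and the image together with `K` is a neighbourhood of `K`. -/
structure IsCollar (K : Set ℂ) (ρ : ℝ) (k : ℂ → ℂ) : Prop where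
  continuousOn : ContinuousOn k (strip ρ)
  periodic : ∀ ζ, k (ζ + τ) = k ζ
  injective : ∀ ζ ∈ strip ρ, ∀ ζ' ∈ strip ρ, k ζ = k ζ' → ∃ n : ℤ, ζ = ζ' + n * τ
  notMem : ∀ ζ ∈ strip ρ, k ζ ∉ K
  tendsto : ∀ U, IsOpen U → K ⊆ U → ∃ y > 0, ∀ ζ ∈ strip y, k ζ ∈ U
  isOpen : ∀ x, 0 < x → x < ρ → IsOpen (K ∪ k '' strip x)

namespace IsCollar

variable {K : Set ℂ} {ρ : ℝ} {k : ℂ → ℂ}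

theorem isCompact_image (hk : IsCollar K ρ k) {a b : ℝ} (ha : 0 < a) (hb : b < ρ) :
    IsCompact (k '' {ζ : ℂ | ζ.re ∈ Icc a b}) :=
  isCompact_image_re_mem_Icc (hk.continuousOn.mono fun _ hζ =>
    ⟨ha.trans_le hζ.1, hζ.2.trans_lt hb⟩) fun ζ _ => hk.periodic ζ

theorem mono (hk : IsCollar K ρ k) {ρ' : ℝ} (h : ρ' ≤ ρ) : IsCollar K ρ' k where
  continuousOn := hk.continuousOn.mono (strip_mono h)
  periodic := hk.periodic
  injective ζ hζ ζ' hζ' := hk.injective ζ (strip_mono h hζ) ζ' (strip_mono h hζ')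
  notMem ζ hζ := hk.notMem ζ (strip_mono h hζ)
  tendsto := hk.tendsto
  isOpen x h0 hx := hk.isOpen x h0 (hx.trans_le h)

theorem map (hk : IsCollar K ρ k) (ψ : OpenPartialHomeomorph ℂ ℂ) (hK : K ⊆ ψ.source)
    (hsrc : ∀ ζ ∈ strip ρ, k ζ ∈ ψ.source) : IsCollar (ψ '' K) ρ (ψ ∘ k) where
  continuousOn := ψ.continuousOn.comp hk.continuousOn hsrc
  periodic ζ := by simp only [Function.comp_apply, hk.periodic]
  injective ζ hζ ζ' hζ' h := hk.injective ζ hζ ζ' hζ' (ψ.injOn (hsrc ζ hζ) (hsrc ζ' hζ') h)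
  notMem ζ hζ := by
    rintro ⟨z, hz, h⟩
    exact hk.notMem ζ hζ (ψ.injOn (hK hz) (hsrc ζ hζ) h ▸ hz)
  tendsto U hU hKU := by
    obtain ⟨y, hy, h⟩ := hk.tendsto _ (ψ.isOpen_inter_preimage hU)
      fun z hz => ⟨hK hz, hKU (mem_image_of_mem _ hz)⟩
    exact ⟨y, hy, fun ζ hζ => (h ζ hζ).2⟩
  isOpen x h0 hx := by
    rw [image_comp, ← image_union]
    refine ψ.isOpen_image_of_subset_source (hk.isOpen x h0 hx) (union_subset hK ?_)
    rintro _ ⟨ζ, hζ, rfl⟩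
    exact hsrc ζ (strip_mono hx.le hζ)

theorem isCompact_union (hk : IsCollar K ρ k) (hK : IsCompact K) {x : ℝ} (hx : x < ρ) :
    IsCompact (K ∪ k '' {ζ : ℂ | 0 < ζ.re ∧ ζ.re ≤ x}) := by
  refine isCompact_of_forall_isOpen hK subset_union_left fun U hU hKU => ?_
  obtain ⟨y, hy, hyU⟩ := hk.tendsto U hU hKU
  refine ⟨k '' {ζ : ℂ | ζ.re ∈ Icc y x}, ?_, hk.isCompact_image hy hx, ?_⟩
  · rintro _ ⟨ζ, hζ, rfl⟩
    exact Or.inr ⟨ζ, ⟨hy.trans_le hζ.1, hζ.2⟩, rfl⟩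
  · rintro z (hz | ⟨ζ, hζ, rfl⟩)
    · exact Or.inl (hKU hz)
    · rcases lt_or_ge ζ.re y with h | h
      · exact Or.inl (hyU ζ ⟨hζ.1, h⟩)
      · exact Or.inr ⟨ζ, ⟨h, hζ.2⟩, rfl⟩

theorem line_mem_strip {x : ℝ} (h0 : 0 < x) (hx : x < ρ) (t : ℝ) :
    (x + t * Complex.I : ℂ) ∈ strip ρ := by
  constructor <;> simpa

theorem continuous_line (hk : IsCollar K ρ k) {x : ℝ} (h0 : 0 < x) (hx : x < ρ) :
    Continuous fun t : ℝ => k (x + t * Complex.I) :=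
  hk.continuousOn.comp_continuous (by fun_prop) (line_mem_strip h0 hx)

theorem periodic_line (hk : IsCollar K ρ k) (x t : ℝ) :
    k (x + (t + 2 * Real.pi : ℝ) * Complex.I) = k (x + t * Complex.I) := by
  rw [← hk.periodic (x + t * Complex.I)]; congr 1; push_cast; ring

theorem re_eq (hk : IsCollar K ρ k) {ζ ζ' : ℂ} (hζ : ζ ∈ strip ρ) (hζ' : ζ' ∈ strip ρ)
    (h : k ζ = k ζ') : ζ.re = ζ'.re := by
  obtain ⟨n, rfl⟩ := hk.injective ζ hζ ζ' hζ' h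
  simp

theorem line_ne (hk : IsCollar K ρ k) {x : ℝ} (h0 : 0 < x) (hx : x < ρ) {η : ℂ}
    (hη : η ∈ strip ρ) (hne : η.re ≠ x) (t : ℝ) : k (x + t * Complex.I) ≠ k η := by
  intro h
  have := hk.re_eq (line_mem_strip h0 hx t) hη h
  apply hne
  simpa using this.symm

theorem isPreconnected_image (hk : IsCollar K ρ k) {a b : ℝ} (ha : 0 ≤ a) (hb : b ≤ ρ) :
    IsPreconnected (k '' {ζ : ℂ | a < ζ.re ∧ ζ.re < b}) :=
  (convex_re_mem_Ioo a b).isPreconnected.image k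
    (hk.continuousOn.mono fun _ hζ => ⟨ha.trans_lt hζ.1, hζ.2.trans_le hb⟩)

/-- The image of a vertical line does not wind around the points of the collar outside of it. -/
theorem hasWinding_outer (hk : IsCollar K ρ k) (hK : IsCompact K) (hne : K.Nonempty) {x : ℝ}
    (h0 : 0 < x) {η : ℂ} (hxη : x < η.re) (hη : η.re < ρ) :
    HasWinding (fun t => k (x + t * Complex.I) - k η) 0 := by
  have hx : x < ρ := hxη.trans hη
  have hηs : η ∈ strip ρ := ⟨h0.trans hxη, hη⟩
  have hγ := hk.continuous_line h0 hx
  have hγp := hk.periodic_line x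
  obtain ⟨a, ha⟩ := exists_hasWinding (γ := fun t : ℝ => k (x + t * Complex.I) - k η)
    (hγ.sub continuous_const) (fun t => sub_ne_zero.2 (hk.line_ne h0 hx hηs hxη.ne' t))
    (fun t => by simp only [hγp])
  have hall : ∀ ζ : ℂ, x < ζ.re → ζ.re < ρ →
      HasWinding (fun t => k (x + t * Complex.I) - k ζ) a := by
    intro ζ h1 h2
    refine HasWinding.of_isPreconnected hγ hγp (hk.isPreconnected_image h0.le le_rfl) ?_
      (mem_image_of_mem k ⟨hxη, hη⟩) (mem_image_of_mem k (show ζ ∈ _ from ⟨h1, h2⟩)) ha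
    rintro t ⟨ζ', hζ', h⟩
    exact hk.line_ne h0 hx ⟨h0.trans hζ'.1, hζ'.2⟩ hζ'.1.ne' t h.symm
  by_cases ha0 : a = 0
  · exact ha0 ▸ ha
  exfalso
  set γ : ℝ → ℂ := fun t => k (x + t * Complex.I) with hγdef
  set C := K ∪ k '' {ζ : ℂ | 0 < ζ.re ∧ ζ.re ≤ x} with hCdef
  have hC : IsCompact C := hk.isCompact_union hK hx
  have hγC : ∀ t, γ t ∈ C := fun t => Or.inr ⟨_, by simpa using h0, rfl⟩
  -- If `a ≠ 0` then `T` is clopen: points off `C` but close to `C` lie in the outer collar, where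
  -- the winding number is `a`, so `T` stays away from `C`. It contains points far away, hence is
  -- the whole plane, although `K ⊆ C` is nonempty.
  set T : Set ℂ := Cᶜ ∩ {q | HasWinding (fun t => γ t - q) 0} with hT
  have hTo : IsOpen T := hC.isClosed.isOpen_compl.inter (isOpen_setOf_hasWinding_sub hγ hγp 0)
  have hTc : IsClosed T := by
    rw [← isOpen_compl_iff, isOpen_iff_mem_nhds]
    intro q hq
    by_cases hqC : q ∈ C
    · obtain ⟨x', hxx', hx'⟩ := exists_between hx
      have hmem : q ∈ K ∪ k '' strip x' := by
        refine hqC.imp id ?_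
        rintro ⟨ζ, hζ, rfl⟩
        exact ⟨ζ, ⟨hζ.1, hζ.2.trans_lt hxx'⟩, rfl⟩
      filter_upwards [(hk.isOpen x' (h0.trans hxx') hx').mem_nhds hmem] with q' hq' hq'T
      rcases hq' with hq' | ⟨ζ, hζ, rfl⟩
      · exact hq'T.1 (Or.inl hq')
      · have h1 : x < ζ.re := by
          by_contra! hle
          exact hq'T.1 (Or.inr ⟨ζ, ⟨hζ.1, hle⟩, rfl⟩)
        exact ha0 (HasWinding.unique (hall ζ h1 (hζ.2.trans hx')) hq'T.2)
    · obtain ⟨b, hb⟩ := exists_hasWinding (γ := fun t : ℝ => γ t - q)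
        (hγ.sub continuous_const)
        (fun t h => hqC (by rw [← sub_eq_zero.1 h]; exact hγC t))
        (fun t => by simp only [hγdef, hγp])
      filter_upwards [(isOpen_setOf_hasWinding_sub hγ hγp b).mem_nhds hb] with q' hq' hq'T
      rw [HasWinding.unique hq' hq'T.2] at hb
      exact hq ⟨hqC, hb⟩
  obtain ⟨R, hR⟩ := hC.isBounded.exists_norm_le
  have hR0 : 0 ≤ R := (norm_nonneg _).trans (hR _ (hγC 0))
  have hfar : ((R + 1 : ℝ) : ℂ) ∈ T := by
    have hn : ‖((R + 1 : ℝ) : ℂ)‖ = R + 1 := by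
      rw [Complex.norm_real, Real.norm_eq_abs, abs_of_nonneg (by linarith)]
    refine ⟨fun h => ?_, hasWinding_sub_of_norm_lt hγ hγp fun t => ?_⟩
    · have := hR _ h
      rw [hn] at this; linarith
    · rw [hn]; linarith [hR _ (hγC t)]
  obtain ⟨p, hp⟩ := hne
  have huniv := IsClopen.eq_univ ⟨hTc, hTo⟩ ⟨_, hfar⟩
  exact (huniv ▸ mem_univ p : p ∈ T).1 (Or.inl hp)

/-- The winding number of the image of a vertical line around `K` is the local degree of the
parametrization. -/
theorem hasWinding_of_hasLocalDegree (hk : IsCollar K ρ k) (hK : IsCompact K)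
    (hKc : IsConnected K) {η : ℂ} (hη0 : 0 < η.re) {x : ℝ} (hηx : η.re < x) (hx : x < ρ) {ε : ℤ}
    (hε : HasLocalDegree k η ε) {p : ℂ} (hp : p ∈ K) :
    HasWinding (fun t => k (x + t * Complex.I) - p) ε := by
  have h0 : 0 < x := hη0.trans hηx
  have hγ := hk.continuous_line h0 hx
  have hγp := hk.periodic_line x
  have hγK : ∀ t : ℝ, k (x + t * Complex.I) ∉ K := fun t => hk.notMem _ (line_mem_strip h0 hx t)
  obtain ⟨b, hb⟩ := exists_hasWinding (γ := fun t : ℝ => k (x + t * Complex.I) - p)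
    (hγ.sub continuous_const) (fun t h => hγK t (by rw [sub_eq_zero.1 h]; exact hp))
    (fun t => by simp only [hγp])
  -- The winding number `b` around `K` persists at collar points close to `K`, then throughout the
  -- connected part of the collar inside the line, in particular at `k η`.
  obtain ⟨y, hy, hyb⟩ := hk.tendsto _ (isOpen_setOf_hasWinding_sub hγ hγp b) fun q hq =>
    HasWinding.of_isPreconnected hγ hγp hKc.isPreconnected hγK hp hq hb
  have hη' : ((min y x / 2 : ℝ) : ℂ).re = min y x / 2 := Complex.ofReal_re _
  have hmin : 0 < min y x := lt_min hy h0
  have h1 : HasWinding (fun t => k (x + t * Complex.I) - k η) b := by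
    refine HasWinding.of_isPreconnected hγ hγp (X := k '' {ζ : ℂ | 0 < ζ.re ∧ ζ.re < x})
      (hk.isPreconnected_image le_rfl hx.le) ?_ (q := k ((min y x / 2 : ℝ) : ℂ))
      (mem_image_of_mem k ⟨by rw [hη']; linarith, by
        rw [hη']; linarith [min_le_right y x]⟩)
      (mem_image_of_mem k ⟨hη0, hηx⟩) (hyb _ ⟨by rw [hη']; linarith, by
        rw [hη']; linarith [min_le_left y x]⟩)
    rintro t ⟨ζ', hζ', h⟩
    exact hk.line_ne h0 hx ⟨hζ'.1, hζ'.2.trans hx⟩ hζ'.2.ne t h.symm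
  have h2 := hk.hasWinding_outer hK hKc.nonempty (half_pos hη0) (half_lt_self hη0)
    (hηx.trans hx)
  have h3 := localDegree_eq_winding_sub_winding hk.continuousOn hk.periodic hk.injective
    (half_pos hη0) (half_lt_self hη0) hηx hx hε h1 h2
  rw [h3, sub_zero]
  exact hb

/-- The point is that `K` stays interior to the new union. The `φ`-image of the line `Re = x` is
compact and misses `K`, so some inner collar `k '' strip s'` avoids it. The `φ`-preimage of that
inner collar is connected, avoids the line and meets `k '' strip x`, hence lies in it; so the new
collar contains the inner one. -/
theorem comp_openPartialHomeomorph (hk : IsCollar K ρ k) (hK : IsCompact K)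
    (φ : OpenPartialHomeomorph ℂ ℂ) (hsrc : ∀ ζ ∈ strip ρ, k ζ ∈ φ.source)
    (htgt : ∀ ζ ∈ strip ρ, k ζ ∈ φ.target) (hφs : Disjoint φ.source K)
    (hφt : Disjoint φ.target K)
    (hφ : ∀ U, IsOpen U → K ⊆ U → ∃ y > 0, ∀ ζ ∈ strip y, φ (k ζ) ∈ U) :
    IsCollar K ρ (φ ∘ k) where
  continuousOn := φ.continuousOn.comp hk.continuousOn hsrc
  periodic ζ := by simp only [Function.comp_apply, hk.periodic]
  injective ζ hζ ζ' hζ' h := hk.injective ζ hζ ζ' hζ' (φ.injOn (hsrc ζ hζ) (hsrc ζ' hζ') h)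
  notMem ζ hζ h := hφt.notMem_of_mem_left (φ.map_source (hsrc ζ hζ)) h
  tendsto := hφ
  isOpen x h0 hx := by
    have hsub : strip x ⊆ strip ρ := strip_mono hx.le
    have hko : IsOpen (k '' strip x) := by
      have : k '' strip x = (K ∪ k '' strip x) \ K := by
        rw [union_sdiff_left, eq_comm, sdiff_eq_left]
        rw [Set.disjoint_left]
        rintro _ ⟨ζ, hζ, rfl⟩
        exact hk.notMem ζ (hsub hζ)
      rw [this]
      exact (hk.isOpen x h0 hx).sdiff hK.isClosed
    have hφo : IsOpen ((φ ∘ k) '' strip x) := by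
      rw [image_comp]
      exact φ.isOpen_image_of_subset_source hko (by rintro _ ⟨ζ, hζ, rfl⟩; exact hsrc ζ (hsub hζ))
    have hlineS : {ζ : ℂ | ζ.re ∈ Icc x x} ⊆ strip ρ := fun ζ hζ =>
      ⟨h0.trans_le hζ.1, hζ.2.trans_lt hx⟩
    have hline : IsCompact ((φ ∘ k) '' {ζ : ℂ | ζ.re ∈ Icc x x}) := by
      rw [image_comp]
      refine (hk.isCompact_image h0 hx).image_of_continuousOn (φ.continuousOn.mono ?_)
      rintro _ ⟨ζ, hζ, rfl⟩
      exact hsrc ζ (hlineS hζ)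
    obtain ⟨s, hs, hsU⟩ := hk.tendsto _ hline.isClosed.isOpen_compl (by
      rintro z hz ⟨ζ, hζ, rfl⟩
      exact hφt.notMem_of_mem_left (φ.map_source (hsrc ζ (hlineS hζ))) hz)
    set s' := min s x
    have hs' : 0 < s' := lt_min hs h0
    have hs'ρ : s' < ρ := (min_le_right _ _).trans_lt hx
    have hs'sub : strip s' ⊆ strip ρ := strip_mono hs'ρ.le
    have hNo := hk.isOpen s' hs' hs'ρ
    have hZt : k '' strip s' ⊆ φ.target := by rintro _ ⟨ζ, hζ, rfl⟩; exact htgt ζ (hs'sub hζ)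
    have hZ : IsPreconnected (φ.symm '' (k '' strip s')) :=
      (hk.isPreconnected_image le_rfl hs'ρ.le).image _ (φ.continuousOn_symm.mono hZt)
    have hZsub : φ.symm '' (k '' strip s') ⊆ k '' strip x := by
      refine hZ.subset_left_of_subset_union hko
        (hk.isCompact_union hK hx).isClosed.isOpen_compl ?_ ?_ ?_
      · rw [Set.disjoint_left]
        rintro _ ⟨ζ, hζ, rfl⟩ h
        exact h (Or.inr ⟨ζ, ⟨hζ.1, hζ.2.le⟩, rfl⟩)
      · rintro _ ⟨z, hz, rfl⟩
        by_cases h : φ.symm z ∈ K ∪ k '' {ζ : ℂ | 0 < ζ.re ∧ ζ.re ≤ x}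
        · left
          rcases h with h | ⟨ζ, hζ, h⟩
          · exact absurd h (hφs.notMem_of_mem_left (φ.map_target (hZt hz)))
          · rcases hζ.2.lt_or_eq with hlt | heq
            · exact ⟨ζ, ⟨hζ.1, hlt⟩, h⟩
            · exfalso
              obtain ⟨ζ', hζ', rfl⟩ := hz
              refine hsU ζ' ⟨hζ'.1, hζ'.2.trans_le (min_le_left _ _)⟩
                ⟨ζ, ⟨heq.ge, heq.le⟩, ?_⟩
              rw [Function.comp_apply, h, φ.right_inv (htgt ζ' (hs'sub hζ'))]
        · exact Or.inr h
      · obtain ⟨y, hy, hyU⟩ := hφ _ hNo subset_union_left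
        have hre : ((min y x / 2 : ℝ) : ℂ).re = min y x / 2 := Complex.ofReal_re _
        have hmin : 0 < min y x := lt_min hy h0
        have hζx : ((min y x / 2 : ℝ) : ℂ) ∈ strip x :=
          ⟨by rw [hre]; linarith, by rw [hre]; linarith [min_le_right y x]⟩
        have hζy : ((min y x / 2 : ℝ) : ℂ) ∈ strip y :=
          ⟨by rw [hre]; linarith, by rw [hre]; linarith [min_le_left y x]⟩
        rcases hyU _ hζy with h | h
        · exact absurd h (hφt.notMem_of_mem_left (φ.map_source (hsrc _ (hsub hζx))))
        · refine ⟨k ((min y x / 2 : ℝ) : ℂ), ⟨_, h, ?_⟩, mem_image_of_mem k hζx⟩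
          exact φ.left_inv (hsrc _ (hsub hζx))
    have heq : K ∪ (φ ∘ k) '' strip x = (K ∪ k '' strip s') ∪ (φ ∘ k) '' strip x := by
      apply Subset.antisymm
      · exact union_subset_union_left _ subset_union_left
      · refine union_subset (union_subset subset_union_left ?_) subset_union_right
        intro z hz
        obtain ⟨ζ, hζ, h⟩ := hZsub (mem_image_of_mem _ hz)
        exact Or.inr ⟨ζ, hζ, by rw [Function.comp_apply, h, φ.right_inv (hZt hz)]⟩
    rw [heq]
    exact hNo.union hφo

/-- A self-map of collars with nonzero, equal local degrees has degree one on the annulus. -/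
theorem period_eq_one (hk : IsCollar K ρ k) (hK : IsCompact K) (hKc : IsConnected K) {ρ' : ℝ}
    {J G : ℂ → ℂ} (hJ : IsCollar K ρ' J) (hG : ContinuousOn G (strip ρ'))
    (hGm : MapsTo G (strip ρ') (strip ρ)) (hkG : ∀ ζ ∈ strip ρ', k (G ζ) = J ζ) {m : ℤ}
    (hm : ∀ ζ ∈ strip ρ', G (ζ + τ) = G ζ + m * τ) {η : ℂ} (hη : η ∈ strip ρ)
    (hη' : η ∈ strip ρ') {ε : ℤ} (hkε : HasLocalDegree k η ε) (hJε : HasLocalDegree J η ε)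
    (hε : ε ≠ 0) : m = 1 := by
  obtain ⟨p, hp⟩ := hKc.nonempty
  obtain ⟨x, hx, hxρ⟩ := exists_between hη.2
  obtain ⟨x', hx', hxρ'⟩ := exists_between hη'.2
  have h1 := hk.hasWinding_of_hasLocalDegree hK hKc hη.1 hx hxρ hkε hp
  have h2 := hJ.hasWinding_of_hasLocalDegree hK hKc hη.1 hx' hxρ' hJε hp
  obtain ⟨Λ, hΛ, hexp, hper⟩ := exists_log_on_strip (F := fun ζ => k ζ - p) (a := 0) (b := ρ)
    (x := x) (y := 0) (n := ε) (hη.1.trans hx) hxρ (hk.continuousOn.sub continuousOn_const)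
    (fun ζ h1 h2 h => hk.notMem ζ ⟨h1, h2⟩ (by rw [sub_eq_zero.1 h]; exact hp))
    (fun ζ _ _ => by simp only [hk.periodic]) (by simpa using h1)
  have hmem := line_mem_strip (ρ := ρ') (hη'.1.trans hx') hxρ'
  -- Since `J = k ∘ G`, the map `Λ ∘ G` is a logarithm of `J - p`; a period moves `G` by `m` periods
  -- and thus `Λ` by `mε` of them.
  have h3 : HasWinding (fun t => J (x' + t * Complex.I) - p) (m * ε) := by
    refine ⟨fun t => Λ (G (x' + t * Complex.I)), ?_, fun t => ?_, fun t => ?_⟩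
    · exact hΛ.comp_continuous (hG.comp_continuous (by fun_prop) hmem) fun t => hGm (hmem t)
    · simp only
      rw [hexp _ (hGm (hmem t)), hkG _ (hmem t)]
    · have h4 : (x' + (t + 2 * Real.pi : ℝ) * Complex.I : ℂ) = x' + t * Complex.I + τ := by
        push_cast; ring
      simp only
      rw [h4, hm _ (hmem t), apply_add_int_mul_period (p := fun r => 0 < r ∧ r < ρ) hper m _
        (hGm (hmem t))]
      push_cast; ring
  have h5 := HasWinding.unique h3 h2
  exact mul_right_cancel₀ hε (by rw [h5, one_mul])

end IsCollar

/-! ### Harnack estimates and bounded hyperbolic displacement -/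

/-- Harnack's inequality for `log (M / ‖h‖)`. With `h = exp g`, `a = log M - Re g(c)` and `t = dist
z c`, Borel–Carathéodory gives `‖g z - g c‖ ≤ 2at/(R - t)`, and `t ≤ R/5` makes this at most `a/2`.
It needs `a > 0`; otherwise the claim is immediate. -/
theorem norm_sq_le_mul_norm_of_ne_zero {h : ℂ → ℂ} {c : ℂ} {R M : ℝ} (hR : 0 < R)
    (hd : DifferentiableOn ℂ h (Metric.ball c R)) (h0 : ∀ z ∈ Metric.ball c R, h z ≠ 0)
    (hM : ∀ z ∈ Metric.ball c R, ‖h z‖ ≤ M) {z : ℂ} (hz : dist z c ≤ R / 5) :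
    ‖h z‖ ^ 2 ≤ M * ‖h c‖ := by
  have hcm : c ∈ Metric.ball c R := Metric.mem_ball_self hR
  have hzm : z ∈ Metric.ball c R := Metric.mem_ball.2 (by linarith)
  have hc0 : 0 < ‖h c‖ := norm_pos_iff.2 (h0 c hcm)
  rcases le_or_gt M ‖h c‖ with hle | hlt
  · have h1 := hM z hzm
    nlinarith [norm_nonneg (h z)]
  have hd' : DifferentiableOn ℂ (fun z => deriv h z / h z) (Metric.ball c R) :=
    (hd.deriv Metric.isOpen_ball).div hd h0
  obtain ⟨g, hgc, hg⟩ := hd'.isExactOn_ball.with_val_at c (Complex.log (h c))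
  have hexp : ∀ w ∈ Metric.ball c R, h w = Complex.exp (g w) := by
    have hder : ∀ w ∈ Metric.ball c R,
        HasDerivAt (fun w => h w * Complex.exp (-g w)) 0 w := by
      intro w hw
      have h1 := (hd.differentiableAt (Metric.isOpen_ball.mem_nhds hw)).hasDerivAt
      have h2 := h1.mul (hg w hw).neg.cexp
      refine h2.congr_deriv ?_
      have h3 : h w * (deriv h w / h w) = deriv h w := mul_div_cancel₀ _ (h0 w hw)
      linear_combination (-Complex.exp (-g w)) * h3
    have hconst : ∀ w ∈ Metric.ball c R,
        h w * Complex.exp (-g w) = h c * Complex.exp (-g c) := fun w hw =>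
      Metric.isOpen_ball.is_const_of_deriv_eq_zero (convex_ball c R).isPreconnected
        (fun v hv => (hder v hv).differentiableAt.differentiableWithinAt)
        (fun v hv => (hder v hv).deriv) hw hcm
    intro w hw
    have h1 := hconst w hw
    rw [hgc, Complex.exp_neg (Complex.log _), Complex.exp_log (h0 c hcm),
      mul_inv_cancel₀ (h0 c hcm), Complex.exp_neg] at h1
    rw [← div_eq_mul_inv, div_eq_one_iff_eq (Complex.exp_ne_zero _)] at h1
    exact h1
  have hnorm : ∀ w ∈ Metric.ball c R, ‖h w‖ = Real.exp (g w).re := fun w hw => by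
    rw [hexp w hw, Complex.norm_exp]
  have hMpos : 0 < M := hc0.trans hlt
  set a := Real.log M - (g c).re with ha
  have ha0 : 0 < a := by
    rw [ha, sub_pos, Real.lt_log_iff_exp_lt hMpos, ← hnorm c hcm]
    exact hlt
  have hshift : ∀ w ∈ Metric.ball (0 : ℂ) R, w + c ∈ Metric.ball c R := fun w hw => by
    rw [mem_ball_iff_norm, add_sub_cancel_right]; exact mem_ball_zero_iff.1 hw
  have hgd : DifferentiableOn ℂ g (Metric.ball c R) := fun w hw =>
    (hg w hw).differentiableAt.differentiableWithinAt
  have hb := Complex.borelCaratheodory_zero (f := fun w => g (w + c) - g c) (R := R) (M := a)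
    (z := z - c) ha0 ((hgd.comp (by fun_prop) hshift).sub_const _) (fun w hw => by
      rw [mem_ofPred_eq, Complex.sub_re, ha]
      apply sub_le_sub_right
      rw [Real.le_log_iff_exp_le hMpos, ← hnorm _ (hshift w hw)]
      exact hM _ (hshift w hw)) hR (by
      rw [mem_ball_zero_iff, ← dist_eq_norm]; linarith) (by simp)
  rw [sub_add_cancel, ← dist_eq_norm z c] at hb
  have hb2 : 2 * a * dist z c / (R - dist z c) ≤ a / 2 := by
    rw [div_le_iff₀ (by linarith)]
    nlinarith
  have hre : (g z).re - (g c).re ≤ a / 2 := by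
    rw [← Complex.sub_re]
    exact (Complex.re_le_norm _).trans (hb.trans hb2)
  rw [hnorm z hzm, hnorm c hcm]
  nth_rewrite 1 [← Real.exp_log hMpos]
  rw [← Real.exp_add, ← Real.exp_nat_mul]
  apply Real.exp_le_exp.2
  push_cast
  linarith

/-- Each link of the chain costs a square root, whence the target `ε ^ 2 / M` one link earlier. What
matters is that `δ` is independent of `h`, the centres and `R`. -/
theorem exists_norm_lt_along_chain {M : ℝ} (hM : 0 < M) (N : ℕ) : ∀ ε > 0, ∃ δ > 0,
    ∀ (h : ℂ → ℂ) (c : ℕ → ℂ) (R : ℝ), 0 < R →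
      (∀ i ≤ N, DifferentiableOn ℂ h (Metric.ball (c i) R)) →
      (∀ i ≤ N, ∀ z ∈ Metric.ball (c i) R, h z ≠ 0) →
      (∀ i ≤ N, ∀ z ∈ Metric.ball (c i) R, ‖h z‖ ≤ M) →
      (∀ i < N, dist (c (i + 1)) (c i) ≤ R / 5) → ‖h (c 0)‖ < δ → ‖h (c N)‖ < ε := by
  induction N with
  | zero => exact fun ε hε => ⟨ε, hε, fun _ _ _ _ _ _ _ _ h => h⟩
  | succ N ih =>
    intro ε hε
    obtain ⟨δ, hδ, H⟩ := ih (ε ^ 2 / M) (by positivity)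
    refine ⟨δ, hδ, fun h c R hR hd h0 hb hc hlt => ?_⟩
    have h1 := H h c R hR (fun i hi => hd i (by omega)) (fun i hi => h0 i (by omega))
      (fun i hi => hb i (by omega)) (fun i hi => hc i (by omega)) hlt
    have h2 := norm_sq_le_mul_norm_of_ne_zero hR (hd N (by omega)) (h0 N (by omega))
      (hb N (by omega)) (hc N (by omega))
    rw [lt_div_iff₀ hM] at h1
    exact lt_of_pow_lt_pow_left₀ 2 hε.le (by linarith)

/-- A bounded nonvanishing holomorphic function near the imaginary axis that is small at `a` is
small at every point within bounded hyperbolic distance of `a`. -/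
theorem exists_norm_lt_of_hyperbolically_close {C c M ε : ℝ} (hC : 0 ≤ C) (hc : 0 < c)
    (hc1 : c ≤ 1) (hM : 0 < M) (hε : 0 < ε) : ∃ δ > 0, ∀ (h : ℂ → ℂ) (a b : ℂ), 0 < a.re →
      ‖b - a‖ ≤ C * a.re → c * a.re ≤ b.re →
      DifferentiableOn ℂ h (strip ((2 + C) * a.re)) → (∀ z ∈ strip ((2 + C) * a.re), h z ≠ 0) →
      (∀ z ∈ strip ((2 + C) * a.re), ‖h z‖ ≤ M) → ‖h a‖ < δ → ‖h b‖ < ε := by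
  -- The segment from `a` to `b` has length at most `C * a.re` and the disks have radius `c * a.re`;
  -- with this `N` each of the `N` equal steps is at most a fifth of the radius.
  obtain ⟨N, hN⟩ := exists_nat_gt (5 * C / c)
  have hN0 : (0 : ℝ) < N := lt_of_le_of_lt (by positivity) hN
  obtain ⟨δ, hδ, H⟩ := exists_norm_lt_along_chain hM N ε hε
  refine ⟨δ, hδ, fun h a b ha hab hb hd h0 hbd hlt => ?_⟩
  set p : ℕ → ℂ := fun i => a + ((i / N : ℝ) : ℂ) * (b - a) with hp
  have hball : ∀ i ≤ N, Metric.ball (p i) (c * a.re) ⊆ strip ((2 + C) * a.re) := by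
    intro i hi z hz
    have hu0 : (0 : ℝ) ≤ i / N := by positivity
    have hu1 : (i / N : ℝ) ≤ 1 := by
      rw [div_le_one hN0]; exact_mod_cast hi
    have hpre : (p i).re = a.re + (i / N : ℝ) * (b.re - a.re) := by
      simp only [hp, Complex.add_re, Complex.re_ofReal_mul, Complex.sub_re]
    have h1 := (Complex.abs_re_le_norm (z - p i)).trans_lt (mem_ball_iff_norm.1 hz)
    have h2 := (Complex.abs_re_le_norm (b - a)).trans hab
    rw [Complex.sub_re] at h1 h2
    rw [abs_lt] at h1
    rw [abs_le] at h2
    have h3 : (p i).re ≥ c * a.re := by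
      rw [hpre]
      have h4 : a.re + (i / N : ℝ) * (b.re - a.re)
        = (1 - i / N) * a.re + (i / N : ℝ) * b.re := by ring
      rw [h4]
      have h5 : c * a.re ≤ a.re := by nlinarith
      nlinarith
    have h6 : (p i).re ≤ a.re + C * a.re := by
      rw [hpre]
      have h7 : 0 ≤ C * a.re := by positivity
      nlinarith
    constructor
    · linarith
    · have : c * a.re ≤ a.re := by nlinarith
      linarith
  have hstep : ∀ i < N, dist (p (i + 1)) (p i) ≤ c * a.re / 5 := by
    intro i _
    have h1 : p (i + 1) - p i = ((1 / N : ℝ) : ℂ) * (b - a) := by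
      simp only [hp]; push_cast; ring
    rw [dist_eq_norm, h1, norm_mul, Complex.norm_real, Real.norm_of_nonneg (by positivity),
      one_div_mul_eq_div, div_le_iff₀ hN0]
    rw [div_lt_iff₀ hc] at hN
    nlinarith
  have := H h p (c * a.re) (by positivity) (fun i hi => hd.mono (hball i hi))
    (fun i hi z hz => h0 z (hball i hi hz)) (fun i hi z hz => hbd z (hball i hi hz)) hstep
    (by simpa [hp] using hlt)
  have hpN : p N = b := by
    simp only [hp]
    rw [div_self hN0.ne']; simp
  rwa [hpN] at this

/-- A map of a strip that commutes with the translation by `2πi` and the multiplication by `d`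
stays within bounded hyperbolic distance of the identity. -/
theorem exists_bounds_of_commute {G : ℂ → ℂ} {r d a : ℝ} (hd : 1 < d) (ha : 0 < a) (har : a < r)
    (hG : ContinuousOn G (strip r)) (hper : ∀ ζ ∈ strip r, G (ζ + τ) = G ζ + τ)
    (hmul : ∀ ζ : ℂ, (d : ℂ) * ζ ∈ strip r → G (d * ζ) = d * G ζ)
    (hpos : ∀ ζ ∈ strip r, 0 < (G ζ).re) :
    ∃ C c : ℝ, 0 ≤ C ∧ 0 < c ∧ c ≤ 1 ∧ ∀ ζ ∈ strip a, ‖G ζ - ζ‖ ≤ C * ζ.re ∧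
      c * ζ.re ≤ (G ζ).re := by
  have hd0 : 0 < d := by linarith
  have hsub : {ζ : ℂ | ζ.re ∈ Icc (a / d) a} ⊆ strip r := fun ζ hζ =>
    ⟨(div_pos ha hd0).trans_le hζ.1, hζ.2.trans_lt har⟩
  -- `a / d ≤ Re ζ ≤ a` is a fundamental domain for multiplication by `d`. The displacement and the
  -- real part of `G` are `τ`-periodic there, so the former is bounded and the latter attains a
  -- positive minimum.
  obtain ⟨C, hC⟩ := (isCompact_image_re_mem_Icc (k := fun ζ => G ζ - ζ)
    ((hG.mono hsub).sub continuousOn_id) (fun ζ hζ => by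
      simp only [hper ζ (hsub hζ)]; ring)).isBounded.exists_norm_le
  have hmin := (isCompact_image_re_mem_Icc (k := fun ζ => ((G ζ).re : ℂ)) (a := a / d) (b := a)
    (Complex.continuous_ofReal.comp_continuousOn
      (Complex.continuous_re.comp_continuousOn (hG.mono hsub))) (fun ζ hζ => by
      simp only [hper ζ (hsub hζ), re_add_period])).exists_isMinOn
        (f := Complex.re) ⟨_, (a : ℂ), by
          simpa using div_le_self ha.le hd.le, rfl⟩ Complex.continuous_re.continuousOn
  obtain ⟨_, ⟨ζ₀, hζ₀, rfl⟩, hζmin⟩ := hmin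
  set m := (G ζ₀).re with hm
  have hm0 : 0 < m := hpos ζ₀ (hsub hζ₀)
  have hmle : ∀ ζ : ℂ, ζ.re ∈ Icc (a / d) a → m ≤ (G ζ).re := fun ζ hζ => by
    simpa using hζmin (mem_image_of_mem (fun ζ => ((G ζ).re : ℂ)) hζ)
  have hCle : ∀ ζ : ℂ, ζ.re ∈ Icc (a / d) a → ‖G ζ - ζ‖ ≤ C := fun ζ hζ =>
    hC _ (mem_image_of_mem (fun ζ => G ζ - ζ) hζ)
  have hC0 : 0 ≤ C := (norm_nonneg _).trans (hCle ζ₀ hζ₀)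
  have hpow : ∀ (n : ℕ) (ζ : ℂ), 0 < ζ.re → d ^ n * ζ.re < r →
      G ((d : ℂ) ^ n * ζ) = (d : ℂ) ^ n * G ζ := by
    intro n
    induction n with
    | zero => intro ζ _ _; simp
    | succ n ih =>
      intro ζ h0 hlt
      have hdn : (0 : ℝ) < d ^ n := by positivity
      have hre : ((d : ℂ) * ((d : ℂ) ^ n * ζ)).re = d ^ (n + 1) * ζ.re := by
        rw [← mul_assoc, ← pow_succ', ← Complex.ofReal_pow, Complex.re_ofReal_mul]
      have h1 : d ^ n * ζ.re < r := by
        refine lt_of_le_of_lt ?_ hlt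
        have : d ^ n ≤ d ^ (n + 1) := pow_le_pow_right₀ hd.le (Nat.le_succ n)
        gcongr
      rw [pow_succ', mul_assoc, hmul _ ⟨by rw [hre]; positivity, by rwa [hre]⟩, ih ζ h0 h1,
        mul_assoc]
  -- For the `n` with `a/d < dⁿ Re ζ ≤ a`, the estimates at `dⁿζ` are divided by `dⁿ`, and `Re ζ / a
  -- ≤ 1/dⁿ < d Re ζ / a`.
  refine ⟨C * d / a, min 1 (m / a), by positivity, lt_min one_pos (by positivity),
    min_le_left _ _, fun ζ hζ => ?_⟩
  obtain ⟨n, hn1, hn2⟩ := exists_nat_pow_near (x := a / ζ.re) (y := d)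
    ((one_le_div hζ.1).2 hζ.2.le) hd
  rw [le_div_iff₀ hζ.1] at hn1
  rw [div_lt_iff₀ hζ.1, pow_succ] at hn2
  have hdn : (0 : ℝ) < d ^ n := by positivity
  have hre : ((d : ℂ) ^ n * ζ).re = d ^ n * ζ.re := by
    rw [← Complex.ofReal_pow, Complex.re_ofReal_mul]
  have hmem : ((d : ℂ) ^ n * ζ).re ∈ Icc (a / d) a := by
    rw [hre]
    refine ⟨?_, hn1⟩
    rw [div_le_iff₀ hd0]; linarith
  have hGn := hpow n ζ hζ.1 (hn1.trans_lt har)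
  have h1 := hCle _ hmem
  have h2 := hmle _ hmem
  rw [hGn] at h1 h2
  rw [← Complex.ofReal_pow, Complex.re_ofReal_mul] at h2
  rw [← mul_sub, norm_mul, norm_pow, Complex.norm_real, Real.norm_of_nonneg hd0.le] at h1
  constructor
  · rw [div_mul_eq_mul_div, le_div_iff₀ ha]
    have h3 : ‖G ζ - ζ‖ * a ≤ ‖G ζ - ζ‖ * (d ^ n * d * ζ.re) :=
      mul_le_mul_of_nonneg_left hn2.le (norm_nonneg _)
    have h4 : d ^ n * ‖G ζ - ζ‖ * (d * ζ.re) ≤ C * (d * ζ.re) :=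
      mul_le_mul_of_nonneg_right h1 (mul_nonneg hd0.le hζ.1.le)
    linarith
  · refine (mul_le_mul_of_nonneg_right (min_le_right _ _) hζ.1.le).trans ?_
    rw [div_mul_eq_mul_div, div_le_iff₀ ha]
    have h5 : 0 < (G ζ).re := hpos ζ (strip_mono har.le hζ)
    nlinarith [hζ.1]

theorem isPreconnected_setOf_lt_norm {R : ℝ} (hR : 0 < R) :
    IsPreconnected {w : ℂ | R < ‖w‖} := by
  have : {w : ℂ | R < ‖w‖} = Complex.exp '' {s : ℂ | Real.log R < s.re} := by
    apply Subset.antisymm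
    · intro w hw
      have hw0 : w ≠ 0 := norm_pos_iff.1 (hR.trans hw)
      refine ⟨Complex.log w, ?_, Complex.exp_log hw0⟩
      rw [mem_ofPred_eq, Complex.log_re]
      exact Real.log_lt_log hR hw
    · rintro _ ⟨s, hs, rfl⟩
      rw [mem_ofPred_eq, Complex.norm_exp, ← Real.log_lt_iff_lt_exp hR]
      exact hs
  rw [this]
  exact (convex_halfSpace_gt Complex.reLm.isLinear _).isPreconnected.image _
    Complex.continuous_exp.continuousOn

/-! ### The collar given by the Böttcher coordinate -/

namespace IsBottcher

variable {P : Polynomial ℂ} {B : OpenPartialHomeomorph ℂ ℂ}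

theorem one_lt_norm (hB : IsBottcher P B) {w : ℂ} (hw : w ∈ B.source) : 1 < ‖B w‖ := by
  have := B.map_source hw
  rwa [hB.target_eq] at this

theorem exp_mem_target (hB : IsBottcher P B) {ζ : ℂ} (hζ : 0 < ζ.re) :
    Complex.exp ζ ∈ B.target := by
  rw [hB.target_eq, mem_ofPred_eq, Complex.norm_exp]
  exact Real.one_lt_exp_iff.2 hζ

theorem exists_norm_bounds (hB : IsBottcher P B) :
    ∃ R > 0, ∀ w : ℂ, R ≤ ‖w‖ → ‖w‖ / 2 ≤ ‖B w‖ ∧ ‖B w‖ < 2 * ‖w‖ := by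
  have h1 : ∀ᶠ w in cocompact ℂ, ‖B w / w - 1‖ < 1 / 2 := by
    filter_upwards [hB.tangent (Metric.ball_mem_nhds 1 (by norm_num : (0 : ℝ) < 1 / 2))] with w hw
    exact mem_ball_iff_norm.1 hw
  rw [← Metric.cobounded_eq_cocompact] at h1
  obtain ⟨R, -, hR⟩ := (hasBasis_cobounded_norm (E := ℂ)).eventually_iff.1 h1
  refine ⟨max R 1, by positivity, fun w hw => ?_⟩
  have hw1 : 1 ≤ ‖w‖ := (le_max_right _ _).trans hw
  have hw0 : w ≠ 0 := norm_pos_iff.1 (by linarith)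
  have h2 := hR (show R ≤ ‖w‖ from (le_max_left _ _).trans hw)
  have h3 : ‖B w - w‖ < ‖w‖ / 2 := by
    have : B w - w = (B w / w - 1) * w := by field_simp
    rw [this, norm_mul]
    nlinarith
  have h4 := norm_sub_norm_le w (B w)
  have h5 := norm_sub_norm_le (B w) w
  rw [norm_sub_rev] at h4
  constructor <;> linarith

/-- The circle `‖w‖ = R` goes into `‖v‖ < 2R`, so the connected set `m < ‖v‖` lies in the image of
the inside or of the outside of the circle. A distant point `u` excludes the inside. -/
theorem exists_norm_le_near (hB : IsBottcher P B) (hK : IsCompact (polyFilledJulia P)) :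
    ∃ R M : ℝ, polyFilledJulia P ⊆ Metric.ball 0 R ∧
      ∀ w ∈ B.source, ‖w‖ < R → ‖B w‖ ≤ M := by
  obtain ⟨R₁, hR₁, hb⟩ := hB.exists_norm_bounds
  obtain ⟨R₂, hR₂⟩ := hK.isBounded.exists_norm_le
  set R := max R₁ (R₂ + 1)
  have hR : 0 < R := lt_max_of_lt_left hR₁
  have hRb : ∀ w : ℂ, R ≤ ‖w‖ → ‖w‖ / 2 ≤ ‖B w‖ ∧ ‖B w‖ < 2 * ‖w‖ := fun w hw =>
    hb w ((le_max_left _ _).trans hw)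
  have hKR : ∀ w ∈ polyFilledJulia P, ‖w‖ < R := fun w hw =>
    (hR₂ w hw).trans_lt ((lt_add_one _).trans_le (le_max_right _ _))
  have hsrc : ∀ w : ℂ, R ≤ ‖w‖ → w ∈ B.source := fun w hw => by
    rw [hB.source_eq]; exact fun h => (hKR w h).not_ge hw
  refine ⟨R, max 1 (2 * R), fun w hw => mem_ball_zero_iff.2 (hKR w hw), fun w hw hwR => ?_⟩
  by_contra! hlt
  set m := max 1 (2 * R)
  have hm : 0 < m := lt_max_of_lt_left one_pos
  have ho1 : IsOpen (B '' (B.source ∩ {z | ‖z‖ < R})) :=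
    B.isOpen_image_of_subset_source
      (B.open_source.inter (isOpen_lt continuous_norm continuous_const)) inter_subset_left
  have ho2 : IsOpen (B '' (B.source ∩ {z | R < ‖z‖})) :=
    B.isOpen_image_of_subset_source
      (B.open_source.inter (isOpen_lt continuous_const continuous_norm)) inter_subset_left
  have hsub := (isPreconnected_setOf_lt_norm hm).subset_left_of_subset_union ho1 ho2 (by
      rw [Set.disjoint_left]
      rintro _ ⟨z, hz, rfl⟩ ⟨z', hz', h⟩
      rw [B.injOn hz'.1 hz.1 h] at hz'
      exact lt_asymm (show R < ‖z‖ from hz'.2) hz.2) (fun v hv => by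
      have hv : m < ‖v‖ := hv
      have hvt : v ∈ B.target := by
        rw [hB.target_eq]; exact (le_max_left _ _).trans_lt hv
      have hvs := B.map_target hvt
      have hv' := B.right_inv hvt
      rcases lt_trichotomy ‖B.symm v‖ R with h | h | h
      · exact Or.inl ⟨_, ⟨hvs, h⟩, hv'⟩
      · exfalso
        have h1 := (hRb _ h.ge).2
        rw [hv', h] at h1
        exact absurd ((le_max_right _ _).trans_lt hv) (not_lt.2 h1.le)
      · exact Or.inr ⟨_, ⟨hvs, h⟩, hv'⟩) ⟨B w, hlt, mem_image_of_mem B ⟨hw, hwR⟩⟩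
  set u : ℂ := ((2 * m + R + 1 : ℝ) : ℂ) with hu
  have hun : ‖u‖ = 2 * m + R + 1 := by
    rw [hu, Complex.norm_real, Real.norm_of_nonneg (by positivity)]
  have huR : R < ‖u‖ := by rw [hun]; linarith
  obtain ⟨z, hz, h⟩ := hsub (show B u ∈ {w : ℂ | m < ‖w‖} by
    have := (hRb u huR.le).1
    rw [mem_ofPred_eq]
    linarith)
  rw [B.injOn hz.1 (hsrc u huR.le) h] at hz
  exact lt_asymm huR hz.2

theorem isCollar (hB : IsBottcher P B) (hK : IsCompact (polyFilledJulia P)) (ρ : ℝ) :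
    IsCollar (polyFilledJulia P) ρ (fun ζ => B.symm (Complex.exp ζ)) where
  continuousOn := B.continuousOn_symm.comp Complex.continuous_exp.continuousOn
    fun ζ hζ => hB.exp_mem_target hζ.1
  periodic ζ := by simp only [exp_add_period]
  injective ζ hζ ζ' hζ' h := Complex.exp_eq_exp_iff_exists_int.1
    (B.symm.injOn (hB.exp_mem_target hζ.1) (hB.exp_mem_target hζ'.1) h)
  notMem ζ hζ := by
    have := B.map_target (hB.exp_mem_target hζ.1)
    rwa [hB.source_eq] at this
  tendsto U hU hKU := by
    obtain ⟨R, hR, hb⟩ := hB.exists_norm_bounds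
    have hc : IsCompact (Uᶜ ∩ Metric.closedBall (0 : ℂ) (max R 4)) :=
      (isCompact_closedBall _ _).inter_left hU.isClosed_compl
    have hsrc : Uᶜ ∩ Metric.closedBall (0 : ℂ) (max R 4) ⊆ B.source := fun w hw => by
      rw [hB.source_eq]; exact fun h => hw.1 (hKU h)
    -- Off `U`, `‖B‖` is bounded below by a constant larger than `1`: by compactness in the ball,
    -- and by tangency at infinity beyond it, where `‖w‖ ≥ 4` forces `‖B w‖ ≥ 2`.
    obtain ⟨m, hm1, hm⟩ : ∃ m > 1, ∀ w ∈ Uᶜ ∩ Metric.closedBall (0 : ℂ) (max R 4),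
        m ≤ ‖B w‖ := by
      rcases (Uᶜ ∩ Metric.closedBall (0 : ℂ) (max R 4)).eq_empty_or_nonempty with he | hne
      · exact ⟨2, by norm_num, by simp [he]⟩
      · obtain ⟨w, hw, hmin⟩ := hc.exists_isMinOn hne (f := fun w => ‖B w‖)
          ((B.continuousOn.mono hsrc).norm)
        exact ⟨_, hB.one_lt_norm (hsrc hw), fun w' hw' => hmin hw'⟩
    refine ⟨Real.log (min m 2), Real.log_pos (lt_min hm1 (by norm_num)), fun ζ hζ => ?_⟩
    have hlt : ‖Complex.exp ζ‖ < min m 2 := by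
      rw [Complex.norm_exp, ← Real.lt_log_iff_exp_lt (lt_min (by linarith) (by norm_num))]
      exact hζ.2
    have hinv := B.right_inv (hB.exp_mem_target hζ.1)
    by_contra hU'
    rcases le_total ‖B.symm (Complex.exp ζ)‖ (max R 4) with h | h
    · have h1 := hm _ ⟨hU', mem_closedBall_zero_iff.2 h⟩
      rw [hinv] at h1
      exact absurd (hlt.trans_le (min_le_left _ _)) (not_lt.2 h1)
    · have h1 := (hb _ ((le_max_left _ _).trans h)).1
      rw [hinv] at h1
      linarith [hlt.trans_le (min_le_right _ _), (le_max_right R 4).trans h]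
  isOpen x h0 _ := by
    obtain ⟨R, M, hKR, hM⟩ := hB.exists_norm_le_near hK
    have hopen : IsOpen (B.source ∩ B ⁻¹' {v | ‖v‖ < Real.exp x}) :=
      B.isOpen_inter_preimage (isOpen_lt continuous_norm continuous_const)
    have hA : IsCompact (B.symm '' {v : ℂ | Real.exp x ≤ ‖v‖ ∧ ‖v‖ ≤ M}) := by
      refine IsCompact.image_of_continuousOn ?_ (B.continuousOn_symm.mono fun v hv => ?_)
      · exact Metric.isCompact_of_isClosed_isBounded
          ((isClosed_le continuous_const continuous_norm).inter
            (isClosed_le continuous_norm continuous_const))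
          ((Metric.isBounded_closedBall (x := 0) (r := M)).subset
            fun v hv => mem_closedBall_zero_iff.2 hv.2)
      · rw [hB.target_eq]
        exact (Real.one_lt_exp_iff.2 h0).trans_le hv.1
    -- Inside the ball of radius `R`, the points of the basin with `e^x ≤ ‖B‖` also satisfy `‖B‖ ≤
    -- M`, so they belong to a compact set whose removal leaves an open set.
    have heq : polyFilledJulia P ∪ (fun ζ => B.symm (Complex.exp ζ)) '' strip x =
        (Metric.ball 0 R ∩ (B.symm '' {v : ℂ | Real.exp x ≤ ‖v‖ ∧ ‖v‖ ≤ M})ᶜ) ∪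
          (B.source ∩ B ⁻¹' {v | ‖v‖ < Real.exp x}) := by
      have hin : ∀ w ∈ B.source, ‖B w‖ < Real.exp x →
          w ∈ (fun ζ => B.symm (Complex.exp ζ)) '' strip x := by
        intro w hw hlt
        have hpos := hB.one_lt_norm hw
        have h0' : B w ≠ 0 := norm_pos_iff.1 (by linarith)
        refine ⟨Complex.log (B w), ⟨?_, ?_⟩, ?_⟩
        · rw [Complex.log_re]; exact Real.log_pos hpos
        · rw [Complex.log_re, Real.log_lt_iff_lt_exp (by linarith)]; exact hlt
        · simp only [Complex.exp_log h0', B.left_inv hw]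
      apply Subset.antisymm
      · rintro w (hw | ⟨ζ, hζ, rfl⟩)
        · refine Or.inl ⟨hKR hw, ?_⟩
          rintro ⟨v, hv, rfl⟩
          have hvt : v ∈ B.target := by
            rw [hB.target_eq]; exact (Real.one_lt_exp_iff.2 h0).trans_le hv.1
          have := B.map_target hvt
          rw [hB.source_eq] at this
          exact this hw
        · refine Or.inr ⟨B.map_target (hB.exp_mem_target hζ.1), ?_⟩
          rw [mem_preimage, B.right_inv (hB.exp_mem_target hζ.1), mem_ofPred_eq, Complex.norm_exp]
          exact Real.exp_lt_exp.2 hζ.2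
      · rintro w (⟨hwR, hw⟩ | ⟨hw, hlt⟩)
        · by_cases hwK : w ∈ polyFilledJulia P
          · exact Or.inl hwK
          · right
            have hws : w ∈ B.source := by rw [hB.source_eq]; exact hwK
            refine hin w hws ?_
            by_contra! hge
            exact hw ⟨B w, ⟨hge, hM w hws (mem_ball_zero_iff.1 hwR)⟩, B.left_inv hws⟩
        · exact Or.inr (hin w hw hlt)
    rw [heq]
    exact (Metric.isOpen_ball.inter hA.isClosed.isOpen_compl).union hopen

end IsBottcher

/-! ### Nested neighbourhoods of the filled Julia set -/

/-- The points whose first `n` iterates lie in `V₂` and whose `n`-th image lies in its closure. -/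
def trap (V₂ : Set ℂ) (f : ℂ → ℂ) : ℕ → Set ℂ
  | 0 => closure V₂
  | n + 1 => V₂ ∩ f ⁻¹' trap V₂ f n

/-- The points whose iterates up to the `n`-th lie in `V₂`. -/
def stay (V₂ : Set ℂ) (f : ℂ → ℂ) : ℕ → Set ℂ
  | 0 => V₂
  | n + 1 => V₂ ∩ f ⁻¹' stay V₂ f n

section Dynamics

variable {V₂ V₁ : Set ℂ} {f : ℂ → ℂ} {d : ℕ}

theorem mem_filledJulia_iff {z : ℂ} :
    z ∈ filledJulia V₂ f ↔ z ∈ V₂ ∧ f z ∈ filledJulia V₂ f := by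
  constructor
  · exact fun h => ⟨h 0, fun n => h (n + 1)⟩
  · rintro ⟨h0, h⟩ n
    cases n with
    | zero => exact h0
    | succ n => exact h n

theorem filledJulia_subset_stay (n : ℕ) : filledJulia V₂ f ⊆ stay V₂ f n := by
  induction n with
  | zero => exact fun z hz => hz 0
  | succ n ih => exact fun z hz =>
      ⟨hz 0, ih (mem_filledJulia_iff.1 hz).2⟩

theorem stay_subset_trap (n : ℕ) : stay V₂ f n ⊆ trap V₂ f n := by
  induction n with
  | zero => exact subset_closure
  | succ n ih => exact fun z hz => ⟨hz.1, ih hz.2⟩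

theorem trap_succ_subset (n : ℕ) : trap V₂ f (n + 1) ⊆ trap V₂ f n := by
  induction n with
  | zero => exact fun z hz => subset_closure hz.1
  | succ n ih => exact fun z hz => ⟨hz.1, ih hz.2⟩

theorem iInter_trap : ⋂ n, trap V₂ f n = filledJulia V₂ f := by
  apply Subset.antisymm
  · intro z hz n
    rw [mem_iInter] at hz
    induction n generalizing z with
    | zero => exact (hz 1).1
    | succ n ih => exact ih fun m => (hz (m + 1)).2
  · exact subset_iInter fun n => (filledJulia_subset_stay n).trans (stay_subset_trap n)

namespace IsPolynomialLike

theorem isCompact_trap (hf : IsPolynomialLike d V₂ V₁ f) (n : ℕ) : IsCompact (trap V₂ f n) := by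
  induction n with
  | zero => exact hf.isCompact_closure
  | succ n ih =>
    refine hf.proper _ (Subset.trans ?_ hf.closure_subset) ih
    exact antitone_nat_of_succ_le (f := trap V₂ f) trap_succ_subset (Nat.zero_le n)

theorem isCompact_filledJulia (hf : IsPolynomialLike d V₂ V₁ f) :
    IsCompact (filledJulia V₂ f) := by
  rw [← iInter_trap]
  exact (hf.isCompact_trap 0).of_isClosed_subset
    (isClosed_iInter fun n => (hf.isCompact_trap n).isClosed) (iInter_subset _ 0)

theorem exists_trap_subset (hf : IsPolynomialLike d V₂ V₁ f) {U : Set ℂ} (hU : IsOpen U)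
    (hKU : filledJulia V₂ f ⊆ U) : ∃ n, trap V₂ f n ⊆ U := by
  rw [← iInter_trap] at hKU
  exact exists_subset_nhds_of_isCompact
    (antitone_nat_of_succ_le (f := trap V₂ f) trap_succ_subset).directed_ge hf.isCompact_trap
    fun x hx => hU.mem_nhds (hKU hx)

theorem isOpen_stay (hf : IsPolynomialLike d V₂ V₁ f) (n : ℕ) : IsOpen (stay V₂ f n) := by
  induction n with
  | zero => exact hf.isOpen_dom
  | succ n ih => exact hf.holomorphic.continuousOn.isOpen_inter_preimage hf.isOpen_dom ih

end IsPolynomialLike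

/-- This is why `φ` tends to `K` at `K`: the sets `stay` are open neighbourhoods of `K`, and the
sets `trap` are compact and decrease to `K`. -/
theorem map_stay_mem_trap {φ : ℂ → ℂ}
    (hφ : ∀ z ∈ V₂ \ filledJulia V₂ f, φ z ∈ V₂ ∧ φ (f z) = f (φ z)) (n : ℕ) :
    ∀ z ∈ stay V₂ f n, z ∉ filledJulia V₂ f → φ z ∈ trap V₂ f n := by
  induction n with
  | zero => exact fun z hz hzK => subset_closure (hφ z ⟨hz, hzK⟩).1
  | succ n ih =>
    intro z hz hzK
    obtain ⟨h1, h2⟩ := hφ z ⟨hz.1, hzK⟩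
    refine ⟨h1, ?_⟩
    rw [mem_preimage, ← h2]
    exact ih (f z) hz.2 fun h => hzK (mem_filledJulia_iff.2 ⟨hz.1, h⟩)

end Dynamics

/-! ### From hyperbolic to Euclidean displacement -/

/-- Injectivity isolates the zeros of `B'`. The inverse is differentiable away from their images and
continuous at them, so these singularities are removable. -/
theorem differentiableOn_symm_of_differentiableOn {B : OpenPartialHomeomorph ℂ ℂ}
    (hB : DifferentiableOn ℂ B B.source) : DifferentiableOn ℂ B.symm B.target := by
  intro w hw
  have hz := B.map_target hw
  set z := B.symm w with hzw
  have hBz : B z = w := B.right_inv hw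
  have han : AnalyticAt ℂ (deriv B) z :=
    (hB.analyticAt (B.open_source.mem_nhds hz)).deriv
  refine (Complex.analyticAt_of_differentiable_on_punctured_nhds_of_continuousAt ?_
    (B.symm.continuousAt hw)).differentiableAt.differentiableWithinAt
  rcases han.eventually_eq_zero_or_eventually_ne_zero with h | h
  · exfalso
    obtain ⟨r, hr, hball⟩ := Metric.mem_nhds_iff.1 (h.and (B.open_source.mem_nhds hz))
    have hz' : z + ((r / 2 : ℝ) : ℂ) ∈ Metric.ball z r := by
      rw [mem_ball_iff_norm, add_sub_cancel_left, Complex.norm_real,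
        Real.norm_of_nonneg (by positivity)]
      linarith
    have hconst := Metric.isOpen_ball.is_const_of_deriv_eq_zero (convex_ball z r).isPreconnected
      (hB.mono fun v hv => (hball hv).2) (fun v hv => (hball hv).1) hz' (Metric.mem_ball_self hr)
    have := B.injOn (hball hz').2 hz hconst
    rw [add_eq_left, Complex.ofReal_eq_zero] at this
    linarith
  · have htend : Tendsto B.symm (𝓝[≠] w) (𝓝[≠] z) := by
      refine tendsto_nhdsWithin_iff.2 ⟨(B.symm.continuousAt hw).tendsto.mono_left
        nhdsWithin_le_nhds, ?_⟩
      filter_upwards [nhdsWithin_le_nhds (B.open_target.mem_nhds hw), self_mem_nhdsWithin]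
        with v hv hvw heq
      exact hvw (B.symm.injOn hv hw heq)
    filter_upwards [htend.eventually h, nhdsWithin_le_nhds (B.open_target.mem_nhds hw)]
      with v hv hvt
    exact (B.hasDerivAt_symm hvt hv ((hB.differentiableAt
      (B.open_source.mem_nhds (B.map_target hvt))).hasDerivAt)).differentiableAt

/-- Both `B⁻¹(e^ζ)` and `B⁻¹(e^(G ζ))` are within `ε/2` of a point `w₀` of `K(P)` chosen close to
the former. This `w₀` varies with `ζ`, which is harmless because `δ` is uniform over all functions
with the same bound. -/
theorem IsBottcher.exists_norm_sub_lt {P : Polynomial ℂ} {B : OpenPartialHomeomorph ℂ ℂ}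
    (hB : IsBottcher P B) (hK : IsCompact (polyFilledJulia P)) {G : ℂ → ℂ}
    {a C c : ℝ} (ha : 0 < a) (hC : 0 ≤ C) (hc : 0 < c) (hc1 : c ≤ 1)
    (hG : ∀ ζ ∈ strip a, ‖G ζ - ζ‖ ≤ C * ζ.re ∧ c * ζ.re ≤ (G ζ).re) {ε : ℝ} (hε : 0 < ε) :
    ∃ y > 0, ∀ ζ ∈ strip y,
      ‖B.symm (Complex.exp (G ζ)) - B.symm (Complex.exp ζ)‖ < ε := by
  have hE := hB.isCollar hK 2
  obtain ⟨M, hM⟩ := (hE.isCompact_union hK (x := 1) (by norm_num)).isBounded.exists_norm_le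
  obtain ⟨δ, hδ, H⟩ := exists_norm_lt_of_hyperbolically_close (M := 2 * |M| + 1) hC hc hc1
    (by positivity) (half_pos hε)
  obtain ⟨y, hy, hyU⟩ := hE.tendsto (Metric.thickening (min δ (ε / 2)) (polyFilledJulia P))
    Metric.isOpen_thickening (Metric.self_subset_thickening (lt_min hδ (half_pos hε)) _)
  -- The term `1 / (2 + C)` keeps the strip of width `(2 + C) * ζ.re` inside `strip 1`, where `M`
  -- bounds `B⁻¹ ∘ exp`.
  refine ⟨min a (min y (1 / (2 + C))), by positivity, fun ζ hζ => ?_⟩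
  have hζa : ζ ∈ strip a := strip_mono (min_le_left _ _) hζ
  have hζy : ζ ∈ strip y := strip_mono ((min_le_right _ _).trans (min_le_left _ _)) hζ
  have hζC : (2 + C) * ζ.re < 1 := by
    have := hζ.2.trans_le ((min_le_right _ _).trans (min_le_right _ _))
    rw [lt_div_iff₀ (by positivity)] at this
    linarith
  obtain ⟨w₀, hw₀, hdist⟩ := Metric.mem_thickening_iff.1 (hyU ζ hζy)
  rw [dist_eq_norm] at hdist
  have hsub : strip ((2 + C) * ζ.re) ⊆ strip 1 := strip_mono hζC.le
  have hsub2 : strip ((2 + C) * ζ.re) ⊆ strip 2 := hsub.trans (strip_mono (by norm_num))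
  have hM0 : ‖w₀‖ ≤ |M| := (hM _ (Or.inl hw₀)).trans (le_abs_self M)
  have h1 := H (fun s => B.symm (Complex.exp s) - w₀) ζ (G ζ) hζ.1 (hG ζ hζa).1 (hG ζ hζa).2
    (((differentiableOn_symm_of_differentiableOn hB.holomorphic).comp
      Complex.differentiable_exp.differentiableOn
      fun s hs => hB.exp_mem_target hs.1).sub_const _)
    (fun s hs h0 => hE.notMem s (hsub2 hs) (by rw [sub_eq_zero.1 h0]; exact hw₀))
    (fun s hs => by
      have h2 : ‖B.symm (Complex.exp s)‖ ≤ |M| :=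
        (hM _ (Or.inr ⟨s, ⟨hs.1, (hsub hs).2.le⟩, rfl⟩)).trans (le_abs_self M)
      linarith [norm_sub_le (B.symm (Complex.exp s)) w₀])
    (hdist.trans_le (min_le_left _ _))
  have h3 := hdist.trans_le (min_le_right _ _)
  calc ‖B.symm (Complex.exp (G ζ)) - B.symm (Complex.exp ζ)‖
      = ‖(B.symm (Complex.exp (G ζ)) - w₀) - (B.symm (Complex.exp ζ) - w₀)‖ := by congr 1; ring
    _ ≤ ‖B.symm (Complex.exp (G ζ)) - w₀‖ + ‖B.symm (Complex.exp ζ) - w₀‖ := norm_sub_le _ _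
    _ < ε := by linarith

/-! ### Lifting `φ` to logarithmic coordinates -/

/-- The Böttcher coordinate transported by `χ`, inverted and written in logarithmic
coordinates. -/
noncomputable def collarMap (χ B : OpenPartialHomeomorph ℂ ℂ) (ζ : ℂ) : ℂ :=
  χ.symm (B.symm (Complex.exp ζ))

section Main

variable {d : ℕ} {V₂ V₁ : Set ℂ} {f : ℂ → ℂ} {P : Polynomial ℂ}
  {χ B : OpenPartialHomeomorph ℂ ℂ}

theorem IsStraightening.map_mem_iff (hχ : IsStraightening d V₂ f P χ) {z : ℂ}
    (hz : z ∈ χ.source) : χ z ∈ polyFilledJulia P ↔ z ∈ filledJulia V₂ f := by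
  rw [← hχ.image_eq]
  constructor
  · rintro ⟨z', hz', h⟩
    exact χ.injOn (hχ.subset_source hz') hz h ▸ hz'
  · exact mem_image_of_mem χ

theorem IsStraightening.isCompact_polyFilledJulia (hχ : IsStraightening d V₂ f P χ)
    (hf : IsPolynomialLike d V₂ V₁ f) : IsCompact (polyFilledJulia P) := by
  rw [← hχ.image_eq]
  exact hf.isCompact_filledJulia.image_of_continuousOn (χ.continuousOn.mono hχ.subset_source)

/-- The collar of `K(P)` is pulled back by `χ`, with `ρ` so small that the points and their
`f`-images stay where `χ` conjugates `f` to `P`; then `B ∘ P = B ^ d` becomes multiplication by `d`.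
-/
theorem exists_isCollar_collarMap (hf : IsPolynomialLike d V₂ V₁ f)
    (hχ : IsStraightening d V₂ f P χ) (hB : IsBottcher P B) :
    ∃ ρ > 0, IsCollar (filledJulia V₂ f) ρ (collarMap χ B) ∧ ∀ ζ ∈ strip ρ,
      B.symm (Complex.exp ζ) ∈ χ.target ∧ collarMap χ B ζ ∈ V₂ ∧
      f (collarMap χ B ζ) = collarMap χ B (d * ζ) ∧
      B (χ (f (collarMap χ B ζ))) = Complex.exp (d * ζ) := by
  have hKP := hχ.isCompact_polyFilledJulia hf
  set W := χ.source ∩ (V₂ ∩ f ⁻¹' χ.source) with hW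
  have hWo : IsOpen W := χ.open_source.inter
    (hf.holomorphic.continuousOn.isOpen_inter_preimage hf.isOpen_dom χ.open_source)
  have hKW : filledJulia V₂ f ⊆ W := fun z hz =>
    ⟨hχ.subset_source hz, hz 0, hχ.subset_source (mem_filledJulia_iff.1 hz).2⟩
  obtain ⟨ρ, hρ, hρW⟩ := (hB.isCollar hKP 1).tendsto (χ.target ∩ χ.symm ⁻¹' W)
    (χ.isOpen_inter_preimage_symm hWo) (by
      rw [← hχ.image_eq]
      rintro _ ⟨z, hz, rfl⟩
      refine ⟨χ.map_source (hχ.subset_source hz), ?_⟩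
      rw [mem_preimage, χ.left_inv (hχ.subset_source hz)]
      exact hKW hz)
  have himg : χ.symm '' polyFilledJulia P = filledJulia V₂ f := by
    rw [← hχ.image_eq]
    exact χ.symm_image_image_of_subset_source hχ.subset_source
  have hcol := (hB.isCollar hKP ρ).map χ.symm (by
      rw [← hχ.image_eq]
      rintro _ ⟨z, hz, rfl⟩
      exact χ.map_source (hχ.subset_source hz)) (fun ζ hζ => (hρW ζ hζ).1)
  rw [himg] at hcol
  refine ⟨ρ, hρ, hcol, fun ζ hζ => ?_⟩
  obtain ⟨ht, hsrc, hV₂, hfsrc⟩ := hρW ζ hζ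
  have hexp := hB.exp_mem_target hζ.1
  have hχk : χ (collarMap χ B ζ) = B.symm (Complex.exp ζ) := χ.right_inv ht
  have hconj : χ (f (collarMap χ B ζ)) = P.eval (B.symm (Complex.exp ζ)) := by
    rw [← hχk]; exact hχ.conj _ hsrc hV₂ hfsrc
  have hBf : B (χ (f (collarMap χ B ζ))) = Complex.exp (d * ζ) := by
    rw [hconj, hB.semiconj _ (B.map_target hexp), B.right_inv hexp, hχ.natDegree_eq,
      Complex.exp_nat_mul]
  refine ⟨ht, hV₂, ?_, hBf⟩
  have hnot : f (collarMap χ B ζ) ∉ filledJulia V₂ f := fun h =>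
    hcol.notMem ζ hζ (mem_filledJulia_iff.2 ⟨hV₂, h⟩)
  have hs : χ (f (collarMap χ B ζ)) ∈ B.source := by
    rw [hB.source_eq]; exact fun h => hnot ((hχ.map_mem_iff hfsrc).1 h)
  rw [show collarMap χ B (d * ζ) = χ.symm (B.symm (Complex.exp (d * ζ))) from rfl, ← hBf,
    B.left_inv hs]
  exact (χ.left_inv hfsrc).symm

end Main

section Main

variable {d : ℕ} {V₂ V₁ : Set ℂ} {f : ℂ → ℂ} {P : Polynomial ℂ}
  {χ B : OpenPartialHomeomorph ℂ ℂ}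

/-- The branch `log ∘ B ∘ χ` is a local left inverse, so the two local degrees have product `1`. The
base point is real to keep `e^x` off the cut of the principal logarithm. -/
theorem exists_hasLocalDegree_collarMap (hB : IsBottcher P B) {ρ : ℝ}
    (hk : IsCollar (filledJulia V₂ f) ρ (collarMap χ B))
    (ht : ∀ ζ ∈ strip ρ, B.symm (Complex.exp ζ) ∈ χ.target) {x : ℝ} (h0 : 0 < x) (hx : x < ρ) :
    ∃ ε : ℤ, ε ≠ 0 ∧ HasLocalDegree (collarMap χ B) x ε := by
  have hxs : (x : ℂ) ∈ strip ρ := ⟨by simpa, by simpa⟩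
  have hpi := Real.pi_pos
  have hUo : IsOpen (strip ρ ∩ {ζ : ℂ | -Real.pi < ζ.im ∧ ζ.im < Real.pi}) :=
    (isOpen_strip ρ).inter ((isOpen_lt continuous_const Complex.continuous_im).inter
      (isOpen_lt Complex.continuous_im continuous_const))
  have hxU : (x : ℂ) ∈ strip ρ ∩ {ζ : ℂ | -Real.pi < ζ.im ∧ ζ.im < Real.pi} :=
    ⟨hxs, by simp [hpi]⟩
  have hinv : ∀ ζ ∈ strip ρ, (χ.trans B) (collarMap χ B ζ) = Complex.exp ζ := fun ζ hζ => by
    simp only [OpenPartialHomeomorph.coe_trans, Function.comp_apply, collarMap]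
    rw [χ.right_inv (ht ζ hζ), B.right_inv (hB.exp_mem_target hζ.1)]
  have hleft : (fun z => Complex.log ((χ.trans B) z)) ∘ collarMap χ B =ᶠ[𝓝 (x : ℂ)] id := by
    filter_upwards [hUo.mem_nhds hxU] with ζ hζ
    simp only [Function.comp_apply, id]
    rw [hinv ζ hζ.1, Complex.log_exp hζ.2.1 hζ.2.2.le]
  obtain ⟨ε, hε⟩ := exists_hasLocalDegree (F := collarMap χ B) (hUo.mem_nhds hxU)
    (hk.continuousOn.mono inter_subset_left) (fun ζ hζ ζ' hζ' h => by
      have h1 := congrArg (fun z => Complex.log ((χ.trans B) z)) h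
      simp only [hinv ζ hζ.1, hinv ζ' hζ'.1] at h1
      rwa [Complex.log_exp hζ.2.1 hζ.2.2.le, Complex.log_exp hζ'.2.1 hζ'.2.2.le] at h1)
  have hW : IsOpen ((χ.trans B).source ∩ (χ.trans B) ⁻¹' Complex.slitPlane) :=
    (χ.trans B).isOpen_inter_preimage Complex.isOpen_slitPlane
  have hkW : collarMap χ B x ∈ (χ.trans B).source ∩ (χ.trans B) ⁻¹' Complex.slitPlane := by
    refine ⟨?_, ?_⟩
    · rw [OpenPartialHomeomorph.trans_source]
      refine ⟨χ.map_target (ht _ hxs), ?_⟩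
      rw [mem_preimage, collarMap, χ.right_inv (ht _ hxs)]
      exact B.map_target (hB.exp_mem_target hxs.1)
    · rw [mem_preimage, hinv _ hxs, ← Complex.ofReal_exp]
      exact Complex.ofReal_mem_slitPlane.2 (Real.exp_pos x)
  obtain ⟨n, hn⟩ := exists_hasLocalDegree (F := fun z => Complex.log ((χ.trans B) z))
    (hW.mem_nhds hkW)
    (((χ.trans B).continuousOn.mono inter_subset_left).clog fun z hz => hz.2)
    (fun z hz z' hz' h => (χ.trans B).injOn hz.1 hz'.1 (by
      have := congrArg Complex.exp h
      simp only at this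
      rwa [Complex.exp_log (Complex.slitPlane_ne_zero hz.2),
        Complex.exp_log (Complex.slitPlane_ne_zero hz'.2)] at this))
  have h1 := (hn.comp hε (hk.continuousOn.continuousAt
    ((isOpen_strip ρ).mem_nhds hxs))).congr hleft
  have h2 := h1.unique (hasLocalDegree_id _)
  exact ⟨ε, right_ne_zero_of_mul (h2 ▸ one_ne_zero), hε⟩

/-- In logarithmic Böttcher coordinates, an orientation-preserving homeomorphism commuting with
`f` commutes with the translation by `2πi`, and with the multiplication by `d` up to a
translation. -/
theorem exists_lift (hf : IsPolynomialLike d V₂ V₁ f) (hd : 0 < d)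
    (hK : IsConnected (filledJulia V₂ f)) {φ : OpenPartialHomeomorph ℂ ℂ}
    (hφs : φ.source = V₁ \ filledJulia V₂ f) (hφt : φ.target = V₁ \ filledJulia V₂ f)
    (hφo : OrientationPreserving φ)
    (hφ : ∀ z ∈ V₂ \ filledJulia V₂ f, φ z ∈ V₂ ∧ φ (f z) = f (φ z))
    (hB : IsBottcher P B) {ρ₀ ρ : ℝ} (hρ : 0 < ρ) (hρρ₀ : ρ < ρ₀)
    (hk : IsCollar (filledJulia V₂ f) ρ₀ (collarMap χ B))
    (hkf : ∀ ζ ∈ strip ρ₀, B.symm (Complex.exp ζ) ∈ χ.target ∧ collarMap χ B ζ ∈ V₂ ∧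
      f (collarMap χ B ζ) = collarMap χ B (d * ζ) ∧
      B (χ (f (collarMap χ B ζ))) = Complex.exp (d * ζ)) :
    ∃ r, 0 < r ∧ r ≤ ρ ∧ ∃ G : ℂ → ℂ, ContinuousOn G (strip r) ∧ MapsTo G (strip r) (strip ρ) ∧
      (∀ ζ ∈ strip r, φ (collarMap χ B ζ) = collarMap χ B (G ζ)) ∧
      (∀ ζ ∈ strip r, G (ζ + τ) = G ζ + τ) ∧
      ∃ κ : ℤ, ∀ ζ : ℂ, (d : ℂ) * ζ ∈ strip r → G (d * ζ) = d * G ζ + κ * τ := by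
  set K := filledJulia V₂ f with hKdef
  set k := collarMap χ B with hkdef
  have hKc : IsCompact K := hf.isCompact_filledJulia
  have hV : V₂ ⊆ V₁ := subset_closure.trans hf.closure_subset
  have hsrc : ∀ ζ ∈ strip ρ₀, k ζ ∈ V₁ \ K := fun ζ hζ =>
    ⟨hV (hkf ζ hζ).2.1, hk.notMem ζ hζ⟩
  have hdisj : Disjoint (V₁ \ K) K := disjoint_sdiff_left
  have hφtend : ∀ U, IsOpen U → K ⊆ U → ∃ y > 0, y ≤ ρ ∧ ∀ ζ ∈ strip y, φ (k ζ) ∈ U := by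
    intro U hU hKU
    obtain ⟨n, hn⟩ := hf.exists_trap_subset hU hKU
    obtain ⟨y, hy, hyn⟩ := hk.tendsto _ (hf.isOpen_stay n) (filledJulia_subset_stay n)
    refine ⟨min y ρ, lt_min hy hρ, min_le_right _ _, fun ζ hζ => hn ?_⟩
    exact map_stay_mem_trap hφ n _ (hyn ζ (strip_mono (min_le_left _ _) hζ))
      (hk.notMem ζ (strip_mono ((min_le_right _ _).trans hρρ₀.le) hζ))
  have hJ : IsCollar K ρ₀ (φ ∘ k) := hk.comp_openPartialHomeomorph hKc φ
    (by rw [hφs]; exact hsrc) (by rw [hφt]; exact hsrc) (by rw [hφs]; exact hdisj)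
    (by rw [hφt]; exact hdisj)
    (fun U hU hKU => (hφtend U hU hKU).imp fun y h => ⟨h.1, h.2.2⟩)
  obtain ⟨r, hr, hrρ, hrN⟩ := hφtend _ (hk.isOpen ρ hρ hρρ₀) subset_union_left
  have hsub : strip r ⊆ strip ρ₀ := strip_mono (hrρ.trans hρρ₀.le)
  have hsubρ : strip ρ ⊆ strip ρ₀ := strip_mono hρρ₀.le
  have himg : ∀ ζ ∈ strip r, ∃ ω ∈ strip ρ, φ (k ζ) = k ω := by
    intro ζ hζ
    rcases hrN ζ hζ with h | ⟨ω, hω, h⟩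
    · exact absurd h (hJ.notMem ζ (hsub hζ))
    · exact ⟨ω, hω, h.symm⟩
  have hχk : ∀ ω ∈ strip ρ₀, χ (k ω) = B.symm (Complex.exp ω) := fun ω hω =>
    χ.right_inv (hkf ω hω).1
  have hinv : ∀ ω ∈ strip ρ₀, (χ.trans B) (k ω) = Complex.exp ω := fun ω hω => by
    simp only [OpenPartialHomeomorph.coe_trans, Function.comp_apply]
    rw [hχk ω hω, B.right_inv (hB.exp_mem_target hω.1)]
  have hsrcΦ : ∀ ω ∈ strip ρ₀, k ω ∈ (χ.trans B).source := fun ω hω => by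
    rw [OpenPartialHomeomorph.trans_source]
    refine ⟨χ.map_target (hkf ω hω).1, ?_⟩
    rw [mem_preimage, hχk ω hω]
    exact B.map_target (hB.exp_mem_target hω.1)
  obtain ⟨G, hG, hGexp⟩ := exists_continuousOn_exp_eq (convex_strip r) (isOpen_strip r)
    (F := fun ζ => (χ.trans B) (φ (k ζ)))
    ((χ.trans B).continuousOn.comp (hJ.continuousOn.mono hsub) fun ζ hζ => by
      obtain ⟨ω, hω, h⟩ := himg ζ hζ
      rw [h]
      exact hsrcΦ ω (hsubρ hω))
    (fun ζ hζ => by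
      obtain ⟨ω, hω, h⟩ := himg ζ hζ
      rw [h, hinv ω (hsubρ hω)]
      exact Complex.exp_ne_zero _)
  have hGω : ∀ ζ ∈ strip r, G ζ ∈ strip ρ ∧ φ (k ζ) = k (G ζ) := by
    intro ζ hζ
    obtain ⟨ω, hω, h⟩ := himg ζ hζ
    have h1 : Complex.exp (G ζ) = Complex.exp ω := by
      rw [hGexp ζ hζ, h, hinv ω (hsubρ hω)]
    have h2 : (G ζ).re = ω.re := by
      have := congrArg norm h1
      rwa [Complex.norm_exp, Complex.norm_exp, Real.exp_eq_exp] at this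
    refine ⟨⟨by rw [h2]; exact hω.1, by rw [h2]; exact hω.2⟩, ?_⟩
    rw [h, hkdef, collarMap, collarMap, h1]
  have hmemτ : ∀ ζ ∈ strip r, ζ + τ ∈ strip r := fun ζ hζ => by
    unfold strip; rw [mem_ofPred_eq, re_add_period]; exact hζ
  obtain ⟨m, hm⟩ := exists_int_of_exp_eq (convex_strip r).isPreconnected
    (L := fun ζ => G (ζ + τ)) (L' := G) (hG.comp (by fun_prop) hmemτ) hG (fun ζ hζ => by
      rw [hGexp _ hζ, hGexp _ (hmemτ ζ hζ), hk.periodic])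
  have hη0 : 0 < r / 2 := by positivity
  have hηr : r / 2 < r := by linarith
  obtain ⟨ε, hε0, hε⟩ := exists_hasLocalDegree_collarMap hB hk (fun ζ hζ => (hkf ζ hζ).1) hη0
    (hηr.trans_le (hrρ.trans hρρ₀.le))
  have hηs : ((r / 2 : ℝ) : ℂ) ∈ strip r :=
    ⟨by rw [Complex.ofReal_re]; exact hη0, by rw [Complex.ofReal_re]; exact hηr⟩
  have hJε : HasLocalDegree (φ ∘ k) ((r / 2 : ℝ) : ℂ) ε := by
    have := (hφo.hasLocalDegree (hφs ▸ hsrc _ (hsub hηs))).comp hε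
      (hk.continuousOn.continuousAt ((isOpen_strip ρ₀).mem_nhds (hsub hηs)))
    rwa [one_mul] at this
  have hm1 : m = 1 := (hk.mono hρρ₀.le).period_eq_one hKc hK (hJ.mono (hrρ.trans hρρ₀.le)) hG
    (fun ζ hζ => (hGω ζ hζ).1) (fun ζ hζ => (hGω ζ hζ).2.symm) hm
    (strip_mono hrρ hηs) hηs hε hJε hε0
  refine ⟨r, hr, hrρ, G, hG, fun ζ hζ => (hGω ζ hζ).1, fun ζ hζ => (hGω ζ hζ).2,
    fun ζ hζ => by rw [hm ζ hζ, hm1]; simp, ?_⟩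
  have hd1 : (1 : ℝ) ≤ d := by exact_mod_cast hd
  have hre : ∀ ζ : ℂ, ((d : ℂ) * ζ).re = d * ζ.re := fun ζ => by simp
  have hdr : ∀ ζ ∈ strip (r / d), (d : ℂ) * ζ ∈ strip r ∧ ζ ∈ strip r := by
    intro ζ hζ
    have h1 := hζ.2
    rw [lt_div_iff₀ (by linarith)] at h1
    have h2 := hζ.1
    refine ⟨⟨by rw [hre]; positivity, by rw [hre]; linarith⟩, h2, by nlinarith⟩
  -- Both sides are logarithms of `B ∘ χ ∘ f ∘ φ ∘ k`, because `φ` commutes with `f` and `f ∘ k` is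
  -- `k` after multiplication by `d`.
  obtain ⟨κ, hκ⟩ := exists_int_of_exp_eq (convex_strip (r / d)).isPreconnected
    (L := fun ζ => G (d * ζ)) (L' := fun ζ => d * G ζ)
    (hG.comp (by fun_prop) fun ζ hζ => (hdr ζ hζ).1)
    (continuousOn_const.mul (hG.mono fun ζ hζ => (hdr ζ hζ).2)) (fun ζ hζ => by
      obtain ⟨h1, h2⟩ := hdr ζ hζ
      obtain ⟨hGm, hGk⟩ := hGω ζ h2
      have h3 := hkf ζ (hsub h2)
      rw [hGexp _ h1, ← h3.2.2.1, (hφ _ ⟨h3.2.1, hk.notMem ζ (hsub h2)⟩).2, hGk]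
      exact (hkf _ (hsubρ hGm)).2.2.2)
  refine ⟨κ, fun ζ hζ => hκ ζ ?_⟩
  have h1 := hζ.1
  have h2 := hζ.2
  rw [hre] at h1 h2
  refine ⟨pos_of_mul_pos_right h1 (by linarith), ?_⟩
  rw [lt_div_iff₀ (by linarith)]; linarith

end Main

end PolyLike

/-! ### The main theorem -/

theorem mainTheorem6 (d : ℕ) (hd : 2 ≤ d) (V₂ V₁ : Set ℂ) (f : ℂ → ℂ)
    (hf : PolyLike.IsPolynomialLike d V₂ V₁ f)
    (hK : IsConnected (PolyLike.filledJulia V₂ f))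
    (φ : OpenPartialHomeomorph ℂ ℂ)
    (hφs : φ.source = V₁ \ PolyLike.filledJulia V₂ f)
    (hφt : φ.target = V₁ \ PolyLike.filledJulia V₂ f)
    (hφo : PolyLike.OrientationPreserving φ)
    (hφ : ∀ z ∈ V₂ \ PolyLike.filledJulia V₂ f, φ z ∈ V₂ ∧ φ (f z) = f (φ z))
    (P : Polynomial ℂ) (χ B : OpenPartialHomeomorph ℂ ℂ)
    (hχ : PolyLike.IsStraightening d V₂ f P χ)
    (hB : PolyLike.IsBottcher P B) :
    ∃ j : ℕ, j < d - 1 ∧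
      PolyLike.ExtendsAsIdentity (PolyLike.filledJulia V₂ f)
        (φ.source ∩ φ ⁻¹' PolyLike.rotationDomain (PolyLike.filledJulia V₂ f) χ B
          (2 * Real.pi * j / ((d : ℝ) - 1)))
        (PolyLike.rotation χ B (2 * Real.pi * j / ((d : ℝ) - 1)) ∘ φ) := by
  open PolyLike in
  obtain ⟨ρ₀, hρ₀, hk, hkf⟩ := exists_isCollar_collarMap hf hχ hB
  obtain ⟨r, hr, hrρ, G, hG, hGm, hGk, hGper, κ, hκ⟩ := exists_lift hf (by omega) hK hφs hφt hφo
    hφ hB (half_pos hρ₀) (half_lt_self hρ₀) hk hkf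
  have hKc := hf.isCompact_filledJulia
  have hKP := hχ.isCompact_polyFilledJulia hf
  set K := filledJulia V₂ f with hKdef
  have hd1 : (0 : ℝ) < (d : ℝ) - 1 := by
    have : (2 : ℝ) ≤ d := by exact_mod_cast hd
    linarith
  have hd1C : (d : ℂ) - 1 ≠ 0 := by exact_mod_cast hd1.ne'
  have hdZ : (0 : ℤ) < (d : ℤ) - 1 := by omega
  set j : ℕ := (κ % ((d : ℤ) - 1)).toNat with hj
  have hj0 := Int.emod_nonneg κ hdZ.ne'
  have hjlt := Int.emod_lt_of_pos κ hdZ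
  have hjκ : (j : ℤ) = κ - ((d : ℤ) - 1) * (κ / ((d : ℤ) - 1)) := by
    rw [hj, Int.toNat_of_nonneg hj0, Int.emod_def]
  refine ⟨j, by omega, ?_⟩
  set θ : ℝ := 2 * Real.pi * j / ((d : ℝ) - 1) with hθ
  -- `s` solves `κτ + s = ds`, so `G + s` commutes with multiplication by `d` exactly. As `j ≡ κ`
  -- modulo `d - 1`, `s` and `iθ` differ by a multiple of `τ`.
  set s : ℂ := κ * (2 * (Real.pi : ℂ) * Complex.I) / ((d : ℂ) - 1) with hs
  have hθs : Complex.exp (θ * Complex.I) = Complex.exp s := by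
    rw [Complex.exp_eq_exp_iff_exists_int]
    refine ⟨-(κ / ((d : ℤ) - 1)), ?_⟩
    have h1 : (j : ℂ) = κ - ((d : ℂ) - 1) * ((κ / ((d : ℤ) - 1) : ℤ) : ℂ) := by
      exact_mod_cast congrArg (Int.cast : ℤ → ℂ) hjκ
    rw [hθ, hs]
    push_cast
    rw [h1]
    field_simp
    ring
  set Gt : ℂ → ℂ := fun ζ => G ζ + s with hGt
  have hsre : s.re = 0 := by
    have : s = ((κ * (2 * Real.pi) / ((d : ℝ) - 1) : ℝ) : ℂ) * Complex.I := by
      rw [hs]; push_cast; ring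
    rw [this, Complex.re_ofReal_mul, Complex.I_re, mul_zero]
  have hGtre : ∀ ζ, (Gt ζ).re = (G ζ).re := fun ζ => by simp [hGt, hsre]
  have hrot : ∀ ζ ∈ strip r, bottcherRotation B θ (χ (φ (collarMap χ B ζ)))
      = B.symm (Complex.exp (Gt ζ)) := by
    intro ζ hζ
    have h1 := hGm hζ
    rw [hGk ζ hζ, bottcherRotation, collarMap,
      χ.right_inv (hkf _ (strip_mono (half_le_self hρ₀.le) h1)).1,
      B.right_inv (hB.exp_mem_target h1.1), hθs, ← Complex.exp_add, add_comm s]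
  have hrρ₀ : strip r ⊆ strip ρ₀ := strip_mono (hrρ.trans (half_le_self hρ₀.le))
  have hGtm : ∀ ζ ∈ strip r, Gt ζ ∈ strip (ρ₀ / 2) := fun ζ hζ => by
    unfold strip; rw [Set.mem_ofPred_eq, hGtre]; exact hGm hζ
  obtain ⟨C, c, hC, hc, hc1, hbound⟩ := exists_bounds_of_commute (G := Gt) (r := r) (d := d)
    (a := r / 2) (by linarith) (half_pos hr) (half_lt_self hr) (hG.add continuousOn_const)
    (fun ζ hζ => by simp only [hGt, hGper ζ hζ]; ring)
    (fun ζ hζ => by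
      simp only [hGt, Complex.ofReal_natCast] at hζ ⊢
      rw [hκ ζ hζ, hs]
      field_simp
      ring)
    (fun ζ hζ => (hGtm ζ hζ).1)
  set D := φ.source ∩ φ ⁻¹' rotationDomain K χ B θ with hD
  have hmemD : ∀ ζ ∈ strip r, collarMap χ B ζ ∈ D := by
    intro ζ hζ
    have hV₂ := (hkf ζ (hrρ₀ hζ)).2.1
    refine ⟨?_, ⟨?_, ?_⟩, ?_⟩
    · rw [hφs]
      exact ⟨hf.closure_subset (subset_closure hV₂), hk.notMem ζ (hrρ₀ hζ)⟩
    · rw [hGk ζ hζ]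
      exact χ.map_target (hkf _ (strip_mono (half_le_self hρ₀.le) (hGm hζ))).1
    · rw [hGk ζ hζ]
      exact hk.notMem _ (strip_mono (half_le_self hρ₀.le) (hGm hζ))
    · rw [hrot ζ hζ]
      exact (hkf _ (strip_mono (half_le_self hρ₀.le) (hGtm ζ hζ))).1
  -- the displacement tends to zero at `K`
  have hdisp : ∀ ε > 0, ∃ y > 0, y < ρ₀ ∧ ∀ ζ ∈ strip y,
      ‖rotation χ B θ (φ (collarMap χ B ζ)) - collarMap χ B ζ‖ < ε := by
    intro ε hε
    -- A compact part of `χ.target` containing both `B⁻¹(e^ζ)` and `B⁻¹(e^(Gt ζ))`, on which `χ⁻¹`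
    -- is uniformly continuous.
    have hQ := (hB.isCollar hKP ρ₀).isCompact_union hKP (half_lt_self hρ₀)
    have hQt : polyFilledJulia P ∪ (fun ζ => B.symm (Complex.exp ζ)) ''
        {ζ : ℂ | 0 < ζ.re ∧ ζ.re ≤ ρ₀ / 2} ⊆ χ.target := by
      rintro w (hw | ⟨ζ, hζ, rfl⟩)
      · rw [← hχ.image_eq] at hw
        obtain ⟨z, hz, rfl⟩ := hw
        exact χ.map_source (hχ.subset_source hz)
      · exact (hkf ζ ⟨hζ.1, hζ.2.trans_lt (half_lt_self hρ₀)⟩).1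
    obtain ⟨δ, hδ, huc⟩ := Metric.uniformContinuousOn_iff.1
      (hQ.uniformContinuousOn_of_continuous (χ.continuousOn_symm.mono hQt)) ε hε
    obtain ⟨y, hy, hyδ⟩ := hB.exists_norm_sub_lt hKP (half_pos hr) hC hc hc1 hbound hδ
    refine ⟨min y r, lt_min hy hr, (min_le_right _ _).trans_lt
      (hrρ.trans_lt (half_lt_self hρ₀)), fun ζ hζ => ?_⟩
    have hζr : ζ ∈ strip r := strip_mono (min_le_right _ _) hζ
    rw [PolyLike.rotation, hrot ζ hζr, ← dist_eq_norm]
    refine huc _ (Or.inr ⟨Gt ζ, ⟨(hGtm ζ hζr).1, (hGtm ζ hζr).2.le⟩, rfl⟩) _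
      (Or.inr ⟨ζ, ⟨hζr.1, (hζr.2.trans_le hrρ).le⟩, rfl⟩) ?_
    rw [dist_eq_norm]
    exact hyδ ζ (strip_mono (min_le_left _ _) hζ)
  constructor
  · have hopen := hk.isOpen r hr (hrρ.trans_lt (half_lt_self hρ₀))
    refine Filter.mem_of_superset (hopen.mem_nhdsSet.2 Set.subset_union_left) ?_
    rintro z (hz | ⟨ζ, hζ, rfl⟩)
    · exact Or.inr hz
    · exact Or.inl (hmemD ζ hζ)
  · intro z hz
    apply ContinuousAt.continuousWithinAt
    by_cases hzK : z ∈ K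
    · rw [Metric.continuousAt_iff']
      intro ε hε
      obtain ⟨y, hy, hyρ, hyε⟩ := hdisp (ε / 2) (half_pos hε)
      filter_upwards [(hk.isOpen y hy hyρ).mem_nhds (Or.inl hzK),
        Metric.ball_mem_nhds z (half_pos hε)] with z' hz' hball
      rw [if_pos hzK]
      have hball' : dist z' z < ε / 2 := hball
      by_cases hz'K : z' ∈ K
      · rw [if_pos hz'K]; linarith
      · rw [if_neg hz'K]
        obtain ⟨ζ, hζ, rfl⟩ := hz'.resolve_left hz'K
        have h1 := hyε ζ hζ
        rw [← dist_eq_norm] at h1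
        exact (dist_triangle _ _ _).trans_lt (by
          rw [Function.comp_apply]; linarith)
    · have hzD : z ∈ D := hz.resolve_right hzK
      obtain ⟨hzs, ⟨hφχ, hφK⟩, hrt⟩ := hzD
      refine ContinuousAt.congr (f := fun w => PolyLike.rotation χ B θ (φ w)) ?_ (by
        filter_upwards [hKc.isClosed.isOpen_compl.mem_nhds hzK] with w hw
        rw [if_neg hw]; rfl)
      have hBs : χ (φ z) ∈ B.source := by
        rw [hB.source_eq]; exact fun h => hφK ((hχ.map_mem_iff hφχ).1 h)
      have hBt : Complex.exp (θ * Complex.I) * B (χ (φ z)) ∈ B.target := by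
        rw [hB.target_eq, Set.mem_ofPred_eq, norm_mul, Complex.norm_exp_ofReal_mul_I, one_mul]
        exact hB.one_lt_norm hBs
      have h1 : ContinuousAt (fun w => B (χ (φ w))) z :=
        ContinuousAt.comp (f := fun w => χ (φ w)) (B.continuousAt hBs)
          (ContinuousAt.comp (χ.continuousAt hφχ) (φ.continuousAt hzs))
      have h2 : ContinuousAt (fun w => B.symm (Complex.exp (θ * Complex.I) * B (χ (φ w)))) z :=
        ContinuousAt.comp (f := fun w => Complex.exp (θ * Complex.I) * B (χ (φ w)))
          (B.symm.continuousAt hBt) (continuousAt_const.mul h1)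
      exact ContinuousAt.comp (f := fun w => B.symm (Complex.exp (θ * Complex.I) * B (χ (φ w))))
        (χ.symm.continuousAt hrt) h2
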